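/- A Pisot number is a real algebraic integer $\beta>1$ all of whose Galois conjugates other than $\beta$ itself have modulus less than $1$. For an integer $n\ge 1$, a Pisot-cyclotomic number of order $n$ is a Pisot number $\beta$ with $\mathbb Z[\beta]=\mathbb Z[2\cos\frac{2\pi}{n}]$. Put $\Delta_n=\{e^{2\pi i j/n}: j\in\mathbb Z\}$, $\mathcal A_n=\Delta_n\cup\{0\}$ and $$X^{\mathcal A_n}(\beta)=\Big\{\sum_{j=0}^{N}a_j\beta^j : N\in\mathbb N,\ a_j\in\mathcal A_n\Big\}\subset\mathbb C .$$ A set $\Lambda\subset\mathbb C$ is relatively dense if there is $\varepsilon>0$ such that every ball of radius $\varepsilon$ in $\mathbb C$ meets $\Lambda$. Let $\tau\approx1.618$, $\lambda\approx2.247$, $\delta\approx2.414$, $\kappa\approx2.879$, $\mu\approx2.732$ be the largest real roots of $x^2-x-1$, $x^3-2x^2-x+1$, $x^2-2x-1$, $x^3-3x^2+1$, $x^2-2x-2$, respectively. (a) For each of the pairs $$(\beta,n)\in\{(\tau,5),(\tau,10),(\tau^2,10),(\lambda,7),(\lambda,14),(\delta,8),(\kappa,18),(\mu,12)\}$$ the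 number $\beta$ is a quadratic or cubic Pisot-cyclotomic number of order $n$, and $X^{\mathcal A_n}(\beta)$ is relatively dense. (b) $\kappa$ is a cubic Pisot-cyclotomic number of order $9$, and $X^{\mathcal A_9}(\kappa)$ is not relatively dense. (c) If $\beta$ is any quadratic or cubic Pisot-cyclotomic number of order $n$, then $X^{\mathcal A_n}(\beta)$ is relatively dense if and only if $(\beta,n)$ is one of the eight pairs in (a). -/

import Mathlib

open Polynomial

noncomputable section

namespace PisotSpectra

/-- A Pisot number: a real algebraic integer `β > 1` all of whose other Galois conjugates
(the other complex roots of its minimal polynomial) are of modulus strictly less than one. -/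
def IsPisot (β : ℝ) : Prop :=
  1 < β ∧ IsIntegral ℤ β ∧
    ∀ z : ℂ, aeval z (minpoly ℚ β) = 0 → z ≠ (β : ℂ) → ‖z‖ < 1

/-- A Pisot-cyclotomic number of order `n`: a Pisot number `β` such that
`ℤ[β] = ℤ[2 cos (2π / n)]`, as subrings of `ℝ`. -/
def IsPisotCyclotomic (n : ℕ) (β : ℝ) : Prop :=
  0 < n ∧ IsPisot β ∧
    Algebra.adjoin ℤ ({β} : Set ℝ) =
      Algebra.adjoin ℤ ({2 * Real.cos (2 * Real.pi / (n : ℝ))} : Set ℝ)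

/-- `β` is algebraic of degree two or three over `ℚ`. -/
def IsQuadraticOrCubic (β : ℝ) : Prop :=
  (minpoly ℚ β).natDegree = 2 ∨ (minpoly ℚ β).natDegree = 3

/-- The set `Δ_n` of all powers of `exp (2πi / n)`, i.e. all `n`-th roots of unity. -/
def polygon (n : ℕ) : Set ℂ :=
  {z | ∃ j : ℤ, z = Complex.exp (2 * Real.pi * Complex.I / (n : ℂ)) ^ j}

/-- The alphabet `A_n = Δ_n ∪ {0}`. -/
def alphabet (n : ℕ) : Set ℂ := polygon n ∪ {0}

/-- The spectrum `X^A(β)`: all sums `∑_{j=0}^N a_j β^j` with `N ∈ ℕ` and all `a_j ∈ A`. -/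
def digitSpectrum (A : Set ℂ) (β : ℝ) : Set ℂ :=
  {z | ∃ (N : ℕ) (a : ℕ → ℂ), (∀ j, a j ∈ A) ∧
    z = ∑ j ∈ Finset.range (N + 1), a j * (β : ℂ) ^ j}

/-- Relative density in the plane: for some `ε > 0`, every ball of radius `ε` meets `Λ`. -/
def IsRelativelyDense (Λ : Set ℂ) : Prop :=
  ∃ ε : ℝ, 0 < ε ∧ ∀ z : ℂ, (Metric.ball z ε ∩ Λ).Nonempty

/-- The largest real root of an integer polynomial (used for polynomials with a real root). -/
def largestRealRoot (p : ℤ[X]) : ℝ := sSup {x : ℝ | aeval x p = 0}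

/-- `τ = 1.618…` -/
def tau : ℝ := largestRealRoot (X ^ 2 - X - 1)

/-- `λ = 2.246…` -/
def lam : ℝ := largestRealRoot (X ^ 3 - 2 * X ^ 2 - X + 1)

/-- `δ = 2.414…` -/
def delta : ℝ := largestRealRoot (X ^ 2 - 2 * X - 1)

/-- `κ = 2.879…` -/
def kappa : ℝ := largestRealRoot (X ^ 3 - 3 * X ^ 2 + 1)

/-- `μ = 2.732…` -/
def mu : ℝ := largestRealRoot (X ^ 2 - 2 * X - 2)

/-- The pairs (base, order) for which the spectrum is claimed to be relatively dense. -/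
def relativelyDensePairs : Set (ℝ × ℕ) :=
  {(tau, 5), (tau, 10), (tau ^ 2, 10), (lam, 7), (lam, 14), (delta, 8), (kappa, 18), (mu, 12)}

end PisotSpectra

end

namespace PisotSpectra

/-! ### Geometry of the spectra -/

/-! Write c = cos(π/n). Two geometric criteria decide every case.

Covering: for β ≤ 4c² - 1 = 1 + 2cos(2π/n), the disc of radius βr about 0, with r = 1/(2c), is
covered by the discs of radius r centred at 0 and at the n-th roots of unity. Choosing digits
greedily from the top then approximates every point of the plane within r, so the spectrum is
relatively dense (`isRelativelyDense_of_le`). All eight pairs satisfy this inequality, six of them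
with equality.

Holes: the hull of the digits is a polygon, and in the direction of an edge normal e the low-order
sums reach only about cβ^N/(β-1). If (β-1)² > 2c²(β-1) + 1 - c², the sums with leading position N,
or a higher one, also avoid a disc centred just beyond that bound, and its radius grows like β^N
(`not_isRelativelyDense_of_lt`). This excludes every β ≥ 3 when n ≥ 4, and also the pairs (τ², 5)
and (κ, 9).

Arithmetic: a base of degree at most 3 forces φ(n) ≤ 6. The orders with 2cos(2π/n) an integer drop
out, leaving n in {5, 7, 8, 9, 10, 12, 14, 18}. In each ring, 1 < β < 3 together with conjugates in
(-1, 1) confines the integer coordinates of β to a bounded set, leaving only τ, τ², λ, δ, κ, μ. -/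

lemma cos_pi_div_pos {n : ℕ} (hn : 4 ≤ n) : 0 < Real.cos (Real.pi / n) := by
  have : (4 : ℝ) ≤ n := by exact_mod_cast hn
  refine Real.cos_pos_of_mem_Ioo ⟨?_, ?_⟩
  · have := Real.pi_pos; have : 0 < Real.pi / n := by positivity
    linarith
  · have := Real.pi_pos
    rw [div_lt_div_iff₀ (by positivity) (by norm_num)]
    nlinarith

lemma exp_zpow_eq (n : ℕ) (j : ℤ) :
    Complex.exp (2 * Real.pi * Complex.I / (n : ℂ)) ^ j =
      Complex.exp ((2 * Real.pi * j / n : ℝ) * Complex.I) := by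
  rw [← Complex.exp_int_mul]
  congr 1
  push_cast
  ring

lemma norm_of_mem_polygon {n : ℕ} {a : ℂ} (ha : a ∈ polygon n) : ‖a‖ = 1 := by
  obtain ⟨j, rfl⟩ := ha
  rw [exp_zpow_eq, Complex.norm_exp_ofReal_mul_I]

lemma norm_le_one_of_mem_alphabet {n : ℕ} {a : ℂ} (ha : a ∈ alphabet n) : ‖a‖ ≤ 1 := by
  rcases ha with ha | ha
  · exact (norm_of_mem_polygon ha).le
  · rw [Set.mem_singleton_iff] at ha
    simp [ha]

/-- The inner product of `exp (iθ)` and `exp (iφ)`. -/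
lemma re_exp_mul_conj_exp (θ φ : ℝ) :
    (Complex.exp (θ * Complex.I) * (starRingEnd ℂ) (Complex.exp (φ * Complex.I))).re =
      Real.cos (θ - φ) := by
  rw [← Complex.exp_conj, ← Complex.exp_add]
  have : (θ : ℂ) * Complex.I + (starRingEnd ℂ) ((φ : ℂ) * Complex.I) =
      ((θ - φ : ℝ) : ℂ) * Complex.I := by
    simp only [map_mul, Complex.conj_ofReal, Complex.conj_I]
    push_cast
    ring
  rw [this, Complex.exp_ofReal_mul_I_re]

/-- The arguments of the vertices are spaced by 2π/n, so rounding the argument of z gives a vertex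
at angle at most π/n from z. -/
lemma exists_mem_polygon_re_ge {n : ℕ} (hn : 0 < n) (z : ℂ) :
    ∃ a ∈ polygon n, ‖z‖ * Real.cos (Real.pi / n) ≤ (z * (starRingEnd ℂ) a).re := by
  have hn' : (0 : ℝ) < n := by exact_mod_cast hn
  have hn1 : (1 : ℝ) ≤ n := by exact_mod_cast hn
  have hpi := Real.pi_pos
  set j : ℤ := round (z.arg * n / (2 * Real.pi)) with hj
  refine ⟨_, ⟨j, rfl⟩, ?_⟩
  rw [exp_zpow_eq]
  conv_rhs => rw [← Complex.norm_mul_exp_arg_mul_I z, mul_assoc, Complex.re_ofReal_mul,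
    re_exp_mul_conj_exp]
  refine mul_le_mul_of_nonneg_left ?_ (norm_nonneg _)
  rw [← Real.cos_abs (z.arg - _)]
  refine Real.cos_le_cos_of_nonneg_of_le_pi (abs_nonneg _) (div_le_self hpi.le hn1) ?_
  have h := abs_sub_round (z.arg * n / (2 * Real.pi))
  rw [← hj] at h
  have e : z.arg - 2 * Real.pi * j / n = (z.arg * n / (2 * Real.pi) - j) * (2 * Real.pi / n) := by
    field_simp
  rw [e, abs_mul, abs_of_pos (show 0 < 2 * Real.pi / n by positivity)]
  calc _ ≤ 1 / 2 * (2 * Real.pi / n) := by gcongr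
    _ = Real.pi / n := by ring

/-- Vertices make odd multiples of π/n with an edge normal. Periodicity modulo 2n and the reflection
m ↦ 2n - m bring the multiple into [1, n], where cosine decreases. -/
lemma cos_odd_mul_pi_div_le {n : ℕ} (hn : 0 < n) (k : ℤ) (hk : Odd k) :
    Real.cos (k * Real.pi / n) ≤ Real.cos (Real.pi / n) := by
  have hn' : (0 : ℝ) < n := by exact_mod_cast hn
  have hpi := Real.pi_pos
  have key : ∀ m : ℤ, 1 ≤ m → m ≤ n → Real.cos (m * Real.pi / n) ≤ Real.cos (Real.pi / n) := by
    intro m h1 h2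
    have h1' : (1 : ℝ) ≤ m := by exact_mod_cast h1
    have h2' : (m : ℝ) ≤ n := by exact_mod_cast h2
    refine Real.cos_le_cos_of_nonneg_of_le_pi (by positivity) ?_ ?_
    · rw [div_le_iff₀ hn']; nlinarith
    · gcongr; nlinarith
  set m := k % (2 * n) with hm
  have hm0 : 0 ≤ m := Int.emod_nonneg _ (by omega)
  have hm1 : m < 2 * n := Int.emod_lt_of_pos _ (by omega)
  have hdiv : k = m + 2 * n * (k / (2 * n)) := (Int.emod_add_mul_ediv k (2 * n)).symm
  have hodd : m ≠ 0 := by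
    intro h0
    rw [h0] at hdiv
    have : Even k := ⟨n * (k / (2 * n)), by linarith⟩
    exact (Int.not_even_iff_odd.mpr hk) this
  have e : Real.cos (k * Real.pi / n) = Real.cos (m * Real.pi / n) := by
    have : (k : ℝ) * Real.pi / n = m * Real.pi / n + (k / (2 * n) : ℤ) * (2 * Real.pi) := by
      have h : (k : ℝ) = m + 2 * n * (k / (2 * n) : ℤ) := by exact_mod_cast hdiv
      rw [h]; field_simp
    rw [this, Real.cos_add_int_mul_two_pi]
  rw [e]
  rcases le_or_gt m n with h | h
  · exact key m (by omega) h
  · have e' : Real.cos (m * Real.pi / n) = Real.cos ((2 * n - m : ℤ) * Real.pi / n) := by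
      have : ((2 * n - m : ℤ) : ℝ) * Real.pi / n = 2 * Real.pi - m * Real.pi / n := by
        push_cast; field_simp
      rw [this, Real.cos_two_pi_sub]
    rw [e']
    exact key _ (by omega) (by omega)

/-- The unit vector normal to an edge of the convex hull of the `n`-th roots of unity. -/
noncomputable def edgeNormal (n : ℕ) : ℂ := Complex.exp ((Real.pi / n : ℝ) * Complex.I)

lemma norm_edgeNormal (n : ℕ) : ‖edgeNormal n‖ = 1 := Complex.norm_exp_ofReal_mul_I _

lemma re_mul_conj_edgeNormal_le {n : ℕ} (hn : 0 < n) {a : ℂ} (ha : a ∈ polygon n) :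
    (a * (starRingEnd ℂ) (edgeNormal n)).re ≤ Real.cos (Real.pi / n) := by
  obtain ⟨j, rfl⟩ := ha
  rw [exp_zpow_eq, edgeNormal, re_exp_mul_conj_exp]
  have h := cos_odd_mul_pi_div_le hn (2 * j - 1) ⟨j - 1, by ring⟩
  convert h using 2
  push_cast
  ring

lemma norm_sub_sq_eq (z w : ℂ) :
    ‖z - w‖ ^ 2 = ‖z‖ ^ 2 + ‖w‖ ^ 2 - 2 * (z * (starRingEnd ℂ) w).re := by
  simp only [← Complex.normSq_eq_norm_sq]
  exact Complex.normSq_sub z w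

/-- The covering of a disc by `n + 1` discs that are smaller by the factor `β`. -/
lemma exists_mem_alphabet_norm_sub_le {n : ℕ} (hn : 0 < n) {β : ℝ}
    (hc : 0 < Real.cos (Real.pi / n)) (h : β ≤ 4 * Real.cos (Real.pi / n) ^ 2 - 1)
    (z : ℂ) (hz : ‖z‖ ≤ β * (1 / (2 * Real.cos (Real.pi / n)))) :
    ∃ a ∈ alphabet n, ‖z - a‖ ≤ 1 / (2 * Real.cos (Real.pi / n)) := by
  obtain ⟨a, ha, hre⟩ := exists_mem_polygon_re_ge hn z
  set c := Real.cos (Real.pi / n)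
  -- The circumradius of the triangle formed by 0 and two adjacent vertices: discs of radius r about
  -- these three points share a boundary point.
  set r := 1 / (2 * c) with hr
  have hr0 : 0 < r := by positivity
  have hrc : 2 * r * c = 1 := by rw [hr]; field_simp
  by_cases hzr : ‖z‖ ≤ r
  · exact ⟨0, Or.inr rfl, by simpa using hzr⟩
  refine ⟨a, Or.inl ha, ?_⟩
  push Not at hzr
  -- Put t = ‖z‖. Since 2rc = 1, t² + 1 - 2tc - r² = (t - r)(t + r - 2c), which is nonpositive for r
  -- ≤ t ≤ 2c - r; the bound on β gives βr ≤ 2c - r.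
  refine le_of_sq_le_sq ?_ hr0.le
  rw [norm_sub_sq_eq, norm_of_mem_polygon ha]
  have h1 : 0 ≤ (‖z‖ - r) * (β * r - ‖z‖) := mul_nonneg (by linarith) (by linarith)
  have h2 : (β + 1) * r ≤ 2 * c := by
    have : (β + 1) * r ≤ 4 * c ^ 2 * r := mul_le_mul_of_nonneg_right (by linarith) hr0.le
    nlinarith
  nlinarith [norm_nonneg z, mul_nonneg (sub_nonneg.mpr h2) (sub_nonneg.mpr hzr.le)]

/-- Greedy expansion: the covering, scaled by β^N, supplies the digit at position N and leaves a
remainder of norm at most β^N r, to which induction applies. -/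
theorem isRelativelyDense_of_le {n : ℕ} (hn : 0 < n) {β : ℝ} (hβ : 1 < β)
    (hc : 0 < Real.cos (Real.pi / n)) (h : β ≤ 4 * Real.cos (Real.pi / n) ^ 2 - 1) :
    IsRelativelyDense (digitSpectrum (alphabet n) β) := by
  have cover := exists_mem_alphabet_norm_sub_le hn hc h
  set r := 1 / (2 * Real.cos (Real.pi / n)) with hr
  have hr0 : 0 < r := by positivity
  have hβ0 : 0 < β := by linarith
  have expand : ∀ (N : ℕ) (z : ℂ), ‖z‖ ≤ β ^ N * r → ∃ a : ℕ → ℂ, (∀ j, a j ∈ alphabet n) ∧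
      ‖z - ∑ j ∈ Finset.range N, a j * (β : ℂ) ^ j‖ ≤ r := by
    intro N
    induction N with
    | zero => exact fun z hz ↦ ⟨fun _ ↦ 0, fun _ ↦ Or.inr rfl, by simpa using hz⟩
    | succ N ih =>
      intro z hz
      have hpow : ‖(β : ℂ) ^ N‖ = β ^ N := by
        rw [norm_pow, Complex.norm_real, Real.norm_of_nonneg hβ0.le]
      have hne : (β : ℂ) ^ N ≠ 0 := pow_ne_zero _ (by exact_mod_cast hβ0.ne')
      obtain ⟨d, hd, hd'⟩ := cover (z / (β : ℂ) ^ N) (by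
        rw [norm_div, hpow, div_le_iff₀ (by positivity)]
        calc _ ≤ _ := hz
          _ = _ := by ring)
      obtain ⟨a, ha, ha'⟩ := ih (z - d * (β : ℂ) ^ N) (by
        have : z - d * (β : ℂ) ^ N = (β : ℂ) ^ N * (z / (β : ℂ) ^ N - d) := by field_simp
        rw [this, norm_mul, hpow]
        gcongr)
      refine ⟨fun j ↦ if j < N then a j else d, fun j ↦ ?_, ?_⟩
      · dsimp only
        split_ifs
        exacts [ha j, hd]
      · simp only [Finset.sum_range_succ, lt_irrefl, if_false]
        rw [Finset.sum_congr rfl (g := fun j ↦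
          a j * (β : ℂ) ^ j) fun j hj ↦ by rw [if_pos (Finset.mem_range.mp hj)]]
        rwa [sub_sub, add_comm] at ha'
  refine ⟨r + 1, by positivity, fun z ↦ ?_⟩
  obtain ⟨N, hN⟩ := pow_unbounded_of_one_lt (‖z‖ / r) hβ
  rw [div_lt_iff₀ hr0] at hN
  -- Members of the spectrum are sums over `range (N + 1)`, so N + 1 digits are taken even though N
  -- would suffice for the norm bound.
  obtain ⟨a, ha, ha'⟩ := expand (N + 1) z
    (hN.le.trans (mul_le_mul_of_nonneg_right (pow_le_pow_right₀ hβ.le N.le_succ) hr0.le))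
  refine ⟨_, ?_, N, a, ha, rfl⟩
  rw [Metric.mem_ball, dist_comm, dist_eq_norm]
  linarith

/-! ### Bounds for digit sums, and holes of the spectrum -/

lemma norm_sum_le {n : ℕ} {β : ℝ} (hβ : 1 < β) {a : ℕ → ℂ} (ha : ∀ j, a j ∈ alphabet n)
    (M : ℕ) : ‖∑ j ∈ Finset.range M, a j * (β : ℂ) ^ j‖ ≤ β ^ M / (β - 1) := by
  have hβ0 : 0 < β := by linarith
  calc _ ≤ ∑ j ∈ Finset.range M, β ^ j := by
        refine norm_sum_le_of_le _ fun j _ ↦ ?_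
        rw [norm_mul, norm_pow, Complex.norm_real, Real.norm_of_nonneg hβ0.le]
        exact mul_le_of_le_one_left (by positivity) (norm_le_one_of_mem_alphabet (ha j))
    _ = (β ^ M - 1) / (β - 1) := geom_sum_eq hβ.ne' M
    _ ≤ _ := by gcongr; linarith

lemma re_sum_mul_conj_le {n : ℕ} (hn : 0 < n) (hc : 0 < Real.cos (Real.pi / n)) {β : ℝ}
    (hβ : 1 < β) {a : ℕ → ℂ} (ha : ∀ j, a j ∈ alphabet n) (M : ℕ) :
    ((∑ j ∈ Finset.range M, a j * (β : ℂ) ^ j) * (starRingEnd ℂ) (edgeNormal n)).re ≤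
      Real.cos (Real.pi / n) * (β ^ M / (β - 1)) := by
  have hβ0 : 0 < β := by linarith
  calc _ = ∑ j ∈ Finset.range M, β ^ j * (a j * (starRingEnd ℂ) (edgeNormal n)).re := by
        rw [Finset.sum_mul, Complex.re_sum]
        refine Finset.sum_congr rfl fun j _ ↦ ?_
        rw [← Complex.re_ofReal_mul]
        push_cast
        ring_nf
    _ ≤ ∑ j ∈ Finset.range M, β ^ j * Real.cos (Real.pi / n) := by
        refine Finset.sum_le_sum fun j _ ↦ mul_le_mul_of_nonneg_left ?_ (by positivity)
        rcases ha j with h | h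
        · exact re_mul_conj_edgeNormal_le hn h
        · rw [Set.mem_singleton_iff.mp h]
          simpa using hc.le
    _ = Real.cos (Real.pi / n) * ((β ^ M - 1) / (β - 1)) := by
        rw [← Finset.sum_mul, geom_sum_eq hβ.ne', mul_comm]
    _ ≤ _ := by gcongr; linarith

/-- A sum of digits either has all its nonzero digits at positions below `N`, or its leading digit
is at a position `K ≥ N`. -/
lemma sum_dichotomy {n : ℕ} (hn : 0 < n) (hc : 0 < Real.cos (Real.pi / n)) {β : ℝ}
    (hβ : 1 < β) {a : ℕ → ℂ} (ha : ∀ j, a j ∈ alphabet n) (N M : ℕ) :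
    ((∑ j ∈ Finset.range M, a j * (β : ℂ) ^ j) * (starRingEnd ℂ) (edgeNormal n)).re ≤
        Real.cos (Real.pi / n) * (β ^ N / (β - 1)) ∨
      ∃ K ≥ N, ∃ d ∈ polygon n, ∃ y : ℂ, ‖y‖ ≤ β ^ K / (β - 1) ∧
        ∑ j ∈ Finset.range M, a j * (β : ℂ) ^ j = d * (β : ℂ) ^ K + y := by
  have hβ1 : 0 ≤ β - 1 := by linarith
  induction M with
  | zero =>
    left
    have : 0 ≤ β ^ N / (β - 1) := by positivity
    simpa using mul_nonneg hc.le this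
  | succ M ih =>
    rcases Nat.lt_or_ge M N with h | h
    · left
      refine (re_sum_mul_conj_le hn hc hβ ha (M + 1)).trans ?_
      have := pow_le_pow_right₀ hβ.le h
      gcongr
    · rcases ha M with h' | h'
      · exact Or.inr ⟨M, h, a M, h', _, norm_sum_le hβ ha M, by
          rw [Finset.sum_range_succ, add_comm]⟩
      · rw [Finset.sum_range_succ, Set.mem_singleton_iff.mp h', zero_mul, add_zero]
        exact ih

/-- Large holes of the spectrum, in the direction of `exp (iπ / n)`. -/
theorem not_isRelativelyDense_of_lt {n : ℕ} (hn : 0 < n) (hc : 0 < Real.cos (Real.pi / n))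
    {β : ℝ} (hβ : 5 / 2 ≤ β)
    (h : 0 < (β - 1) ^ 2 - 2 * Real.cos (Real.pi / n) ^ 2 * (β - 1) -
      (1 - Real.cos (Real.pi / n) ^ 2)) :
    ¬ IsRelativelyDense (digitSpectrum (alphabet n) β) := by
  rintro ⟨ε, hε, hball⟩
  have hβ1 : 1 < β := by linarith
  have hβ0 : 0 < β := by linarith
  have hc1 : Real.cos (Real.pi / n) ≤ 1 := Real.cos_le_one _
  have dich : ∀ {a : ℕ → ℂ}, _ := fun {a} ha N M ↦ sum_dichotomy hn hc hβ1 (a := a) ha N M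
  have hedge : ∀ {a : ℂ}, _ := fun {a} ha ↦ re_mul_conj_edgeNormal_le hn (a := a) ha
  set c := Real.cos (Real.pi / n)
  have hu : 0 < β - 1 := by linarith
  set s := 1 / (β - 1) with hs
  have hs0 : 0 < s := by positivity
  have hsu : s * (β - 1) = 1 := by rw [hs]; field_simp
  -- This is the hypothesis `h` divided by (β - 1)². It says that the point cse is farther than s
  -- from every vertex.
  have hD : 0 < 1 - 2 * c ^ 2 * s - s ^ 2 * (1 - c ^ 2) := by
    have : 1 - 2 * c ^ 2 * s - s ^ 2 * (1 - c ^ 2) =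
        s ^ 2 * ((β - 1) ^ 2 - 2 * c ^ 2 * (β - 1) - (1 - c ^ 2)) := by
      linear_combination (-1 - s * (β - 1) + 2 * c ^ 2 * s) * hsu
    rw [this]; positivity
  have hs1 : s ≤ 2 / 3 := by nlinarith
  -- Sums with leading position above N stay away from cseβ^N: after scaling by β^N their norm is at
  -- least β(1 - s).
  have hE : 0 < β * (1 - s) - c * s := by
    have : β * (1 - s) = β - 1 - s := by linear_combination -hsu
    nlinarith
  obtain ⟨δ, hδ, hδD, hδE⟩ : ∃ δ : ℝ, 0 < δ ∧ 2 * δ * (c + s) ≤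
      1 - 2 * c ^ 2 * s - s ^ 2 * (1 - c ^ 2) ∧ 2 * δ ≤ β * (1 - s) - c * s := by
    refine ⟨min ((1 - 2 * c ^ 2 * s - s ^ 2 * (1 - c ^ 2)) / (2 * (c + s)))
      ((β * (1 - s) - c * s) / 2), by positivity, ?_, ?_⟩
    · have := min_le_left ((1 - 2 * c ^ 2 * s - s ^ 2 * (1 - c ^ 2)) / (2 * (c + s)))
        ((β * (1 - s) - c * s) / 2)
      rw [le_div_iff₀ (by positivity)] at this
      linarith
    · have := min_le_right ((1 - 2 * c ^ 2 * s - s ^ 2 * (1 - c ^ 2)) / (2 * (c + s)))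
        ((β * (1 - s) - c * s) / 2)
      linarith
  set e := edgeNormal n with he
  have hne : ‖e‖ = 1 := norm_edgeNormal n
  -- The disc about ρeβ^N of radius δβ^N will be free of points of the spectrum; N is taken so large
  -- that δβ^N exceeds ε.
  set ρ := c * s + δ with hρ
  have hρ0 : 0 < ρ := by positivity
  obtain ⟨N, hN⟩ := pow_unbounded_of_one_lt (ε / δ) hβ1
  rw [div_lt_iff₀ hδ] at hN
  obtain ⟨x, hx, M, a, ha, rfl⟩ := hball (ρ * e * (β : ℂ) ^ N)
  rw [Metric.mem_ball, dist_eq_norm] at hx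
  have hx' := hx.trans hN
  have hpow : ∀ K : ℕ, ‖(β : ℂ) ^ K‖ = β ^ K := fun K ↦ by
    rw [norm_pow, Complex.norm_real, Real.norm_of_nonneg hβ0.le]
  have hPN : 0 < β ^ N := by positivity
  have hdiv : ∀ K : ℕ, β ^ K / (β - 1) = s * β ^ K := fun K ↦ by rw [hs]; ring
  have hee : e * (starRingEnd ℂ) e = 1 := by
    rw [Complex.mul_conj, Complex.normSq_eq_norm_sq, hne]; simp
  rcases dich ha N (M + 1) with hre | ⟨K, hK, d, hd, y, hy, hxy⟩
  · set x := ∑ j ∈ Finset.range (M + 1), a j * (β : ℂ) ^ j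
    have h1 : ((ρ * e * (β : ℂ) ^ N - x) * (starRingEnd ℂ) e).re ≤ ‖x - ρ * e * (β : ℂ) ^ N‖ := by
      refine (Complex.re_le_norm _).trans ?_
      rw [norm_mul, RCLike.norm_conj, hne, mul_one, norm_sub_rev]
    have h2 : ((ρ * e * (β : ℂ) ^ N - x) * (starRingEnd ℂ) e).re =
        ρ * β ^ N - (x * (starRingEnd ℂ) e).re := by
      have : (ρ * e * (β : ℂ) ^ N - x) * (starRingEnd ℂ) e =
          ((ρ * β ^ N : ℝ) : ℂ) - x * (starRingEnd ℂ) e := by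
        push_cast
        linear_combination (ρ * (β : ℂ) ^ N) * hee
      rw [this, Complex.sub_re, Complex.ofReal_re]
    rw [hdiv] at hre
    nlinarith
  · rw [hxy] at hx'
    rw [hdiv] at hy
    rcases hK.eq_or_lt with rfl | hK
    -- Leading position exactly N: the remaining digits move the sum by at most sβ^N, so a vertex at
    -- distance s + δ from ρe is far enough.
    · have h1 : s + δ ≤ ‖ρ * e - d‖ := by
        refine le_of_sq_le_sq ?_ (norm_nonneg _)
        rw [norm_sub_rev, norm_sub_sq_eq, norm_of_mem_polygon hd, norm_mul, hne, Complex.norm_real,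
          Real.norm_of_nonneg hρ0.le]
        have : (d * (starRingEnd ℂ) (ρ * e)).re = ρ * (d * (starRingEnd ℂ) e).re := by
          rw [← Complex.re_ofReal_mul, map_mul, Complex.conj_ofReal]
          ring_nf
        rw [this]
        have := mul_le_mul_of_nonneg_left (hedge hd) hρ0.le
        nlinarith [mul_pos hδ (mul_pos hc hs0)]
      have h2 : ‖(ρ * e - d) * (β : ℂ) ^ N‖ ≤
          ‖d * (β : ℂ) ^ N + y - ρ * e * (β : ℂ) ^ N‖ + ‖y‖ := by
        rw [norm_sub_rev (d * (β : ℂ) ^ N + y)]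
        refine le_trans (le_of_eq ?_) (norm_add_le _ _)
        ring_nf
      rw [norm_mul, hpow] at h2
      nlinarith
    · have h1 : ‖d * (β : ℂ) ^ K‖ ≤ ‖d * (β : ℂ) ^ K + y - ρ * e * (β : ℂ) ^ N‖ + ‖y‖ +
          ‖ρ * e * (β : ℂ) ^ N‖ := by
        refine le_trans (le_of_eq ?_) ((norm_add_le _ _).trans
          (add_le_add_left (norm_sub_le (d * (β : ℂ) ^ K + y - ρ * e * (β : ℂ) ^ N) y) _))
        ring_nf
      rw [norm_mul, norm_mul, norm_mul, hpow, hpow, norm_of_mem_polygon hd, hne, Complex.norm_real,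
        Real.norm_of_nonneg hρ0.le] at h1
      have h2 : β ^ N * β ≤ β ^ K := by
        rw [← pow_succ]; exact pow_le_pow_right₀ hβ1.le hK
      nlinarith [mul_le_mul_of_nonneg_right h2 (show 0 ≤ 1 - s by linarith)]

theorem not_isRelativelyDense_of_three_le {n : ℕ} (hn : 4 ≤ n) {β : ℝ} (hβ : 3 ≤ β) :
    ¬ IsRelativelyDense (digitSpectrum (alphabet n) β) := by
  have hc := cos_pi_div_pos hn
  have hn' : (4 : ℝ) ≤ n := by exact_mod_cast hn
  have hc1 : Real.cos (Real.pi / n) < 1 := by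
    rw [← Real.cos_zero]
    refine Real.cos_lt_cos_of_nonneg_of_le_pi le_rfl (div_le_self Real.pi_pos.le (by linarith)) ?_
    have := Real.pi_pos
    positivity
  refine not_isRelativelyDense_of_lt (by omega) hc (by linarith) ?_
  set c := Real.cos (Real.pi / n)
  -- The expression equals 3(1 - c²) + (β - 3)(β + 1 - 2c²), that is, its value at β = 3 plus a
  -- nonnegative term.
  nlinarith [mul_nonneg (show 0 ≤ β - 3 by linarith) (show 0 ≤ β + 1 - 2 * c ^ 2 by nlinarith)]

/-! ### Orders with a real subfield of degree at most three -/

/-- The totient of a prime power dividing n divides φ(n), and the maximal prime powers of totient at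
most 6 are 8, 9, 5 and 7, with product 2520. -/
lemma dvd_of_totient_le_six {n : ℕ} (hn : 0 < n) (h : n.totient ≤ 6) : n ∣ 2520 := by
  refine (Nat.dvd_iff_prime_pow_dvd_dvd 2520 n).mpr fun p k hp hpk ↦ ?_
  rcases Nat.eq_zero_or_pos k with rfl | hk
  · simp
  have h1 : p ^ (k - 1) * (p - 1) ≤ 6 := by
    rw [← Nat.totient_prime_pow hp hk]
    exact (Nat.le_of_dvd (Nat.totient_pos.mpr hn) (Nat.totient_dvd_of_dvd hpk)).trans h
  have h2 := hp.two_le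
  have h3 : p - 1 ≤ 6 := le_trans (Nat.le_mul_of_pos_left _ (by positivity)) h1
  have h4 : k - 1 < 3 := by
    by_contra! h4
    have h5 : 2 ^ 3 ≤ p ^ (k - 1) :=
      (Nat.pow_le_pow_left h2 3).trans (Nat.pow_le_pow_right (by omega) h4)
    have h6 : p ^ (k - 1) ≤ p ^ (k - 1) * (p - 1) := Nat.le_mul_of_pos_right _ (by omega)
    omega
  have hp7 : p ≤ 7 := by omega
  have hk3 : k ≤ 3 := by omega
  interval_cases p <;> interval_cases k <;> simp_all +decide

lemma mem_of_totient_le_six {n : ℕ} (hn : 0 < n) (h : n.totient ≤ 6) :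
    n ∈ ({1, 2, 3, 4, 5, 6, 7, 8, 9, 10, 12, 14, 18} : Finset ℕ) := by
  have hd : n ∈ Nat.divisors 2520 :=
    Nat.mem_divisors.mpr ⟨dvd_of_totient_le_six hn h, by norm_num⟩
  have key : ∀ m ∈ Nat.divisors 2520, m.totient ≤ 6 →
      m ∈ ({1, 2, 3, 4, 5, 6, 7, 8, 9, 10, 12, 14, 18} : Finset ℕ) := by
    decide +kernel
  exact key n hd h

/-- The degree of `exp (2πi / n)` is at most twice the degree of its real part (doubled). -/
lemma totient_le_of_natDegree_le {n : ℕ} (hn : 0 < n) {d : ℕ} {g : ℚ[X]} (hg : g.Monic)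
    (hd : g.natDegree = d) (hroot : aeval (2 * Real.cos (2 * Real.pi / n)) g = 0) :
    n.totient ≤ 2 * d := by
  set ζ := Complex.exp (2 * Real.pi * Complex.I / n) with hζ
  have hprim : IsPrimitiveRoot ζ n := Complex.isPrimitiveRoot_exp n hn.ne'
  have hζ0 : ζ ≠ 0 := Complex.exp_ne_zero _
  have hcos : ((2 * Real.cos (2 * Real.pi / n) : ℝ) : ℂ) = ζ + ζ⁻¹ := by
    rw [hζ, ← Complex.exp_neg]
    push_cast
    rw [Complex.two_cos]
    congr 2 <;> ring
  have hroot' : aeval (ζ + ζ⁻¹) g = 0 := by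
    rw [← hcos]
    have := congrArg (algebraMap ℝ ℂ) hroot
    rwa [← aeval_algebraMap_apply, map_zero] at this
  -- This is X^d · g(X + 1/X) with denominators cleared. Its constant term is the leading
  -- coefficient of g, so it is nonzero.
  set q : ℚ[X] := ∑ i ∈ Finset.range (d + 1), C (g.coeff i) * (X ^ 2 + 1) ^ i * X ^ (d - i) with hq
  have hq0 : aeval ζ q = 0 := by
    have : aeval ζ q = ζ ^ d * aeval (ζ + ζ⁻¹) g := by
      rw [hq, aeval_eq_sum_range (p := g), hd, map_sum, Finset.mul_sum]
      refine Finset.sum_congr rfl fun i hi ↦ ?_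
      have hi' : i ≤ d := by simpa [Nat.lt_succ_iff] using hi
      have e : ζ ^ 2 + 1 = ζ * (ζ + ζ⁻¹) := by field_simp
      simp only [map_mul, aeval_C, map_pow, map_add, aeval_X, map_one]
      rw [e, mul_pow, Algebra.smul_def, ← Nat.sub_add_cancel hi', pow_add]
      simp only [Nat.add_sub_cancel]
      ring
    rw [this, hroot', mul_zero]
  have hqd : q.coeff 0 = 1 := by
    rw [coeff_zero_eq_eval_zero, hq, eval_finsetSum, Finset.sum_eq_single d]
    · simp [← hd, hg.coeff_natDegree]
    · intro i hi hid
      have : d - i ≠ 0 := by have := Finset.mem_range.mp hi; omega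
      simp [this]
    · simp
  have hqle : q.natDegree ≤ 2 * d := by
    refine natDegree_sum_le_of_forall_le _ _ fun i hi ↦ ?_
    have hi' := Finset.mem_range.mp hi
    have h1 : (X ^ 2 + 1 : ℚ[X]).natDegree ≤ 2 := by compute_degree
    have h2 := natDegree_pow_le_of_le i h1
    have h3 := natDegree_mul_le_of_le (natDegree_mul_le_of_le (natDegree_C (g.coeff i)).le h2)
      (natDegree_X_pow_le (R := ℚ) (d - i))
    exact h3.trans (by omega)
  have hne : q ≠ 0 := by
    rintro h0
    simp [h0] at hqd
  have h1 := natDegree_le_of_dvd (minpoly.dvd ℚ ζ hq0) hne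
  rw [← cyclotomic_eq_minpoly_rat hprim hn, natDegree_cyclotomic] at h1
  exact h1.trans hqle

/-- The order of a Pisot-cyclotomic number of degree `d` satisfies `φ(n) ≤ 2d`. -/
lemma totient_le_of_isPisotCyclotomic {n : ℕ} {β : ℝ} (h : IsPisotCyclotomic n β) :
    n.totient ≤ 2 * (minpoly ℚ β).natDegree := by
  obtain ⟨hn, ⟨-, hint, -⟩, hadj⟩ := h
  set η := 2 * Real.cos (2 * Real.pi / (n : ℝ)) with hη
  have hβ : IsIntegral ℚ β := hint.tower_top
  have hmem : η ∈ IntermediateField.adjoin ℚ {β} := by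
    have h1 : η ∈ Algebra.adjoin ℤ {β} := hadj ▸ Algebra.self_mem_adjoin_singleton ℤ η
    have h2 : Algebra.adjoin ℤ {β} ≤
        (IntermediateField.adjoin ℚ {β}).toSubalgebra.restrictScalars ℤ := by
      rw [Algebra.adjoin_le_iff, Set.singleton_subset_iff]
      exact IntermediateField.mem_adjoin_simple_self ℚ β
    exact h2 h1
  have := IntermediateField.adjoin.finiteDimensional hβ
  have h3 := minpoly.natDegree_le (A := ℚ) (⟨η, hmem⟩ : IntermediateField.adjoin ℚ {β})
  rw [IntermediateField.adjoin.finrank hβ] at h3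
  have h4 : minpoly ℚ (⟨η, hmem⟩ : IntermediateField.adjoin ℚ {β}) = minpoly ℚ η :=
    (minpoly.algebraMap_eq (algebraMap (IntermediateField.adjoin ℚ {β}) ℝ).injective _).symm
  rw [h4] at h3
  have hi : IsIntegral ℚ η := by
    have := IsIntegral.of_finite ℚ (⟨η, hmem⟩ : IntermediateField.adjoin ℚ {β})
    exact this.algebraMap (B := ℝ)
  exact (totient_le_of_natDegree_le hn (minpoly.monic hi) rfl (minpoly.aeval ℚ η)).trans (by omega)

/-! ### Integral polynomials of degree two and three -/

section Roots

variable {p : ℤ[X]}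

lemma minpoly_eq_map (hp : p.Monic) (hirr : Irreducible p) {x : ℝ} (hx : aeval x p = 0) :
    minpoly ℚ x = p.map (algebraMap ℤ ℚ) := by
  refine (minpoly.eq_of_irreducible_of_monic
    ((hp.irreducible_iff_irreducible_map_fraction_map (K := ℚ)).mp hirr) ?_ (hp.map _)).symm
  rwa [aeval_map_algebraMap]

lemma natDegree_minpoly_eq (hp : p.Monic) (hirr : Irreducible p) {x : ℝ} (hx : aeval x p = 0) :
    (minpoly ℚ x).natDegree = p.natDegree := by
  rw [minpoly_eq_map hp hirr hx, hp.natDegree_map]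

lemma natDegree_minpoly_ratCast (q : ℚ) : (minpoly ℚ (q : ℝ)).natDegree = 1 := by
  have := minpoly.eq_X_sub_C ℝ q
  rw [eq_ratCast] at this
  rw [this, natDegree_X_sub_C]

/-- In degrees 2 and 3 only integer roots need excluding. The modulus 4 serves all the polynomials
here; modulo 2 those of δ and μ acquire roots. -/
lemma irreducible_of_zmod_four (hp : p.Monic) (h2 : 2 ≤ p.natDegree) (h3 : p.natDegree ≤ 3)
    (h : ∀ a : ZMod 4, (p.map (Int.castRingHom (ZMod 4))).eval a ≠ 0) : Irreducible p := by
  rw [hp.irreducible_iff_roots_eq_zero_of_degree_le_three h2 h3]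
  refine Multiset.eq_zero_of_forall_notMem fun a ha ↦ h a ?_
  have := (mem_roots'.mp ha).2
  rw [IsRoot.def] at this
  rw [eval_intCast_map]
  simp [this]

lemma isPisot_of_roots (hp : p.Monic) {x : ℝ} (hx1 : 1 < x) (hx : aeval x p = 0)
    (h : ∀ z : ℂ, aeval z p = 0 → z ≠ x → ‖z‖ < 1) : IsPisot x := by
  refine ⟨hx1, ⟨p, hp, hx⟩, fun z hz ↦ h z ?_⟩
  have hd : minpoly ℚ x ∣ p.map (algebraMap ℤ ℚ) :=
    minpoly.dvd ℚ x (by rwa [aeval_map_algebraMap])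
  have := aeval_eq_zero_of_dvd_aeval_eq_zero hd hz
  rwa [aeval_map_algebraMap] at this

lemma largestRealRoot_eq {x : ℝ} (hx : aeval x p = 0) (h : ∀ y : ℝ, aeval y p = 0 → y ≤ x) :
    largestRealRoot p = x :=
  IsGreatest.csSup_eq ⟨hx, fun y hy ↦ h y hy⟩

lemma exists_aeval_eq_of_mem_adjoin (hp : p.Monic) (h1 : p.natDegree ≠ 0) {x β : ℝ}
    (hx : aeval x p = 0) (hβ : β ∈ Algebra.adjoin ℤ {x}) :
    ∃ q : ℤ[X], q.natDegree < p.natDegree ∧ aeval x q = β := by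
  rw [Algebra.adjoin_singleton_eq_range_aeval] at hβ
  obtain ⟨q, rfl⟩ := hβ
  refine ⟨q %ₘ p, natDegree_modByMonic_lt q hp ?_, ?_⟩
  · rintro rfl
    exact h1 natDegree_one
  · exact aeval_modByMonic_eq_self_of_root hx

/-- The minimal polynomial of q(x), composed with q, vanishes at x, hence is divisible by p and
vanishes at y too. -/
lemma aeval_minpoly_conj (hp : p.Monic) (hirr : Irreducible p) {x y : ℝ} (hx : aeval x p = 0)
    (hy : aeval y p = 0) (q : ℤ[X]) : aeval (aeval y q) (minpoly ℚ (aeval x q)) = 0 := by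
  have e : ∀ t : ℝ, aeval t ((minpoly ℚ (aeval x q)).comp (q.map (algebraMap ℤ ℚ))) =
      aeval (aeval t q) (minpoly ℚ (aeval x q)) := fun t ↦ by
    rw [aeval_comp, aeval_map_algebraMap]
  have hd : minpoly ℚ x ∣ (minpoly ℚ (aeval x q)).comp (q.map (algebraMap ℤ ℚ)) :=
    minpoly.dvd ℚ x (by rw [e, minpoly.aeval])
  rw [minpoly_eq_map hp hirr hx] at hd
  rw [← e]
  exact aeval_eq_zero_of_dvd_aeval_eq_zero hd (by rwa [aeval_map_algebraMap])

lemma abs_conj_lt_one (hp : p.Monic) (hirr : Irreducible p) {x y : ℝ} (hx : aeval x p = 0)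
    (hy : aeval y p = 0) {q : ℤ[X]} (hβ : IsPisot (aeval x q)) (hne : aeval y q ≠ aeval x q) :
    |aeval y q| < 1 := by
  have h := hβ.2.2 ((aeval y q : ℝ) : ℂ) (by
    have := congrArg (algebraMap ℝ ℂ) (aeval_minpoly_conj hp hirr hx hy q)
    rwa [← aeval_algebraMap_apply, map_zero] at this) (by exact_mod_cast hne)
  rwa [Complex.norm_real] at h

end Roots

section Roots

variable {p : ℤ[X]}

lemma aeval_real_of_complex {t : ℝ} : aeval (t : ℂ) p = ((aeval t p : ℝ) : ℂ) :=
  aeval_algebraMap_apply ℂ t p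

lemma aeval_real_eq_zero {t : ℝ} (h : aeval (t : ℂ) p = 0) : aeval t p = 0 := by
  rw [aeval_real_of_complex] at h
  exact_mod_cast h

lemma ne_ratCast_of_natDegree_ne_one {β : ℝ} (h : (minpoly ℚ β).natDegree ≠ 1) (a : ℚ) :
    β ≠ a := by
  rintro rfl
  exact h (natDegree_minpoly_ratCast a)

lemma isPisot_and_natDegree_quadratic (hp : p.Monic) (hd : p.natDegree = 2) (hirr : Irreducible p)
    {x y : ℝ} (hz : ∀ z : ℂ, aeval z p = (z - x) * (z - y)) (hx : 1 < x) (hy : |y| < 1) :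
    IsPisot x ∧ (minpoly ℚ x).natDegree = 2 ∧ largestRealRoot p = x := by
  have hx0 : aeval x p = 0 := aeval_real_eq_zero (by rw [hz]; ring)
  refine ⟨isPisot_of_roots hp hx hx0 fun z h0 hne ↦ ?_, hd ▸ natDegree_minpoly_eq hp hirr hx0,
    largestRealRoot_eq hx0 fun t ht ↦ ?_⟩
  · rw [hz, mul_eq_zero, sub_eq_zero, sub_eq_zero] at h0
    rcases h0 with h0 | rfl
    · exact absurd h0 hne
    · rwa [Complex.norm_real]
  · have h0 : aeval (t : ℂ) p = 0 := by rw [aeval_real_of_complex, ht, Complex.ofReal_zero]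
    rw [hz, mul_eq_zero, sub_eq_zero, sub_eq_zero] at h0
    rcases h0 with h0 | h0
    · exact le_of_eq (by exact_mod_cast h0)
    · have : t = y := by exact_mod_cast h0
      linarith [le_abs_self y]

lemma isPisot_and_natDegree_cubic (hp : p.Monic) (hd : p.natDegree = 3) (hirr : Irreducible p)
    {x y w : ℝ} (hz : ∀ z : ℂ, aeval z p = (z - x) * (z - y) * (z - w)) (hx : 1 < x)
    (hy : |y| < 1) (hw : |w| < 1) :
    IsPisot x ∧ (minpoly ℚ x).natDegree = 3 ∧ largestRealRoot p = x := by
  have hx0 : aeval x p = 0 := aeval_real_eq_zero (by rw [hz]; ring)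
  refine ⟨isPisot_of_roots hp hx hx0 fun z h0 hne ↦ ?_, hd ▸ natDegree_minpoly_eq hp hirr hx0,
    largestRealRoot_eq hx0 fun t ht ↦ ?_⟩
  · rw [hz, mul_eq_zero, mul_eq_zero, sub_eq_zero, sub_eq_zero, sub_eq_zero] at h0
    rcases h0 with (h0 | rfl) | rfl
    · exact absurd h0 hne
    · rwa [Complex.norm_real]
    · rwa [Complex.norm_real]
  · have h0 : aeval (t : ℂ) p = 0 := by rw [aeval_real_of_complex, ht, Complex.ofReal_zero]
    rw [hz, mul_eq_zero, mul_eq_zero, sub_eq_zero, sub_eq_zero, sub_eq_zero] at h0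
    rcases h0 with (h0 | h0) | h0
    · exact le_of_eq (by exact_mod_cast h0)
    · have : t = y := by exact_mod_cast h0
      linarith [le_abs_self y]
    · have : t = w := by exact_mod_cast h0
      linarith [le_abs_self w]

lemma exists_eq_of_isPisot_quadratic (hp : p.Monic) (hd : p.natDegree = 2) (hirr : Irreducible p)
    {x y : ℝ} (hz : ∀ z : ℂ, aeval z p = (z - x) * (z - y)) (hxy : y < x) {β : ℝ}
    (hβ : IsPisot β) (hdeg : (minpoly ℚ β).natDegree ≠ 1) (hmem : β ∈ Algebra.adjoin ℤ {x}) :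
    ∃ a b : ℤ, β = a + b * x ∧ |a + b * y| < 1 := by
  have hx0 : aeval x p = 0 := aeval_real_eq_zero (by rw [hz]; ring)
  have hy0 : aeval y p = 0 := aeval_real_eq_zero (by rw [hz]; ring)
  obtain ⟨q, hq, rfl⟩ := exists_aeval_eq_of_mem_adjoin hp (by omega) hx0 hmem
  rw [hd] at hq
  have e : ∀ t : ℝ, aeval t q = q.coeff 0 + q.coeff 1 * t := fun t ↦ by
    rw [aeval_eq_sum_range' hq]
    simp [Finset.sum_range_succ]
  refine ⟨q.coeff 0, q.coeff 1, e x, ?_⟩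
  rw [← e]
  refine abs_conj_lt_one hp hirr hx0 hy0 hβ fun h ↦ ?_
  rw [e, e] at h
  have h1 : (q.coeff 1 : ℝ) * (x - y) = 0 := by linarith
  have h2 : (q.coeff 1 : ℝ) = 0 := (mul_eq_zero.mp h1).resolve_right (by linarith)
  refine ne_ratCast_of_natDegree_ne_one hdeg (q.coeff 0) ?_
  rw [e, h2]
  push_cast
  ring

/-- The Pisot bound applies only to conjugates different from β. A coincidence gives b + c(x + y) =
0, where x + y = A - w, so either w is rational or b = c = 0 and β is rational. -/
lemma conj_ne_cubic (hp : p.Monic) (hd : p.natDegree = 3) (hirr : Irreducible p)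
    {x y w : ℝ} {A : ℤ} (hA : x + y + w = A) (hw : aeval w p = 0) (hxy : x ≠ y) {a b c : ℤ}
    (hdeg : (minpoly ℚ (a + b * x + c * x ^ 2 : ℝ)).natDegree ≠ 1) :
    (a + b * y + c * y ^ 2 : ℝ) ≠ a + b * x + c * x ^ 2 := by
  intro h
  have h1 : (x - y) * (b + c * (x + y)) = 0 := by linear_combination -h
  have h2 := (mul_eq_zero.mp h1).resolve_left (sub_ne_zero.mpr hxy)
  have h3 : (c : ℝ) * w = b + c * A := by linear_combination c * hA - h2
  rcases eq_or_ne c 0 with rfl | hc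
  · have hb : (b : ℝ) = 0 := by simpa using h2
    refine ne_ratCast_of_natDegree_ne_one hdeg a ?_
    simp [hb]
  · have hc' : (c : ℝ) ≠ 0 := by exact_mod_cast hc
    refine ne_ratCast_of_natDegree_ne_one (β := w) ?_ ((b + c * A) / c) ?_
    · rw [natDegree_minpoly_eq hp hirr hw]; omega
    · push_cast
      field_simp
      linarith

lemma exists_eq_of_isPisot_cubic (hp : p.Monic) (hd : p.natDegree = 3) (hirr : Irreducible p)
    {x y w : ℝ} (hz : ∀ z : ℂ, aeval z p = (z - x) * (z - y) * (z - w)) {A : ℤ}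
    (hA : x + y + w = A) (hxy : y < x) (hxw : w < x) {β : ℝ}
    (hβ : IsPisot β) (hdeg : (minpoly ℚ β).natDegree ≠ 1) (hmem : β ∈ Algebra.adjoin ℤ {x}) :
    ∃ a b c : ℤ, β = a + b * x + c * x ^ 2 ∧ |a + b * y + c * y ^ 2| < 1 ∧
      |a + b * w + c * w ^ 2| < 1 := by
  have hx0 : aeval x p = 0 := aeval_real_eq_zero (by rw [hz]; ring)
  have hy0 : aeval y p = 0 := aeval_real_eq_zero (by rw [hz]; ring)
  have hw0 : aeval w p = 0 := aeval_real_eq_zero (by rw [hz]; ring)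
  obtain ⟨q, hq, rfl⟩ := exists_aeval_eq_of_mem_adjoin hp (by omega) hx0 hmem
  rw [hd] at hq
  have e : ∀ t : ℝ, aeval t q = q.coeff 0 + q.coeff 1 * t + q.coeff 2 * t ^ 2 := fun t ↦ by
    rw [aeval_eq_sum_range' hq]
    simp [Finset.sum_range_succ]
  refine ⟨q.coeff 0, q.coeff 1, q.coeff 2, e x, ?_, ?_⟩
  · rw [← e]
    refine abs_conj_lt_one hp hirr hx0 hy0 hβ ?_
    rw [e] at hdeg
    rw [e, e]
    exact conj_ne_cubic hp hd hirr hA hw0 hxy.ne' hdeg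
  · rw [← e]
    refine abs_conj_lt_one hp hirr hx0 hw0 hβ ?_
    rw [e] at hdeg
    rw [e, e]
    exact conj_ne_cubic hp hd hirr (by linarith : x + w + y = A) hy0 hxw.ne' hdeg

end Roots

/-! ### Comparison of the rings ℤ[x], and the covering criterion in terms of 2cos(2π/n) -/

lemma adjoin_eq_of_eq {x y : ℝ} {a b c d e f : ℤ} (hx : x = a + b * y + c * y ^ 2)
    (hy : y = d + e * x + f * x ^ 2) :
    Algebra.adjoin ℤ ({x} : Set ℝ) = Algebra.adjoin ℤ {y} := by
  have key : ∀ {s t : ℝ} {a b c : ℤ}, s = a + b * t + c * t ^ 2 →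
      Algebra.adjoin ℤ {s} ≤ Algebra.adjoin ℤ {t} := by
    rintro s t a b c rfl
    rw [Algebra.adjoin_le_iff, Set.singleton_subset_iff, Algebra.adjoin_singleton_eq_range_aeval]
    exact ⟨C a + C b * X + C c * X ^ 2, by simp⟩
  exact le_antisymm (key hx) (key hy)

lemma exists_int_eq_of_mem_adjoin {m : ℤ} {β : ℝ} (h : β ∈ Algebra.adjoin ℤ {(m : ℝ)}) :
    ∃ k : ℤ, β = k := by
  have h1 : Algebra.adjoin ℤ {(m : ℝ)} ≤ ⊥ := by
    rw [Algebra.adjoin_le_iff, Set.singleton_subset_iff]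
    exact Algebra.mem_bot.mpr ⟨m, by simp⟩
  obtain ⟨k, hk⟩ := Algebra.mem_bot.mp (h1 h)
  exact ⟨k, by simpa using hk.symm⟩

lemma one_add_two_mul_cos_eq (n : ℕ) :
    1 + 2 * Real.cos (2 * Real.pi / n) = 4 * Real.cos (Real.pi / n) ^ 2 - 1 := by
  rw [Real.cos_sq, show 2 * (Real.pi / n) = 2 * Real.pi / n by ring]
  ring

theorem isRelativelyDense_of_le_cos {n : ℕ} (hn : 4 ≤ n) {β : ℝ} (hβ : 1 < β)
    (h : β ≤ 1 + 2 * Real.cos (2 * Real.pi / n)) :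
    IsRelativelyDense (digitSpectrum (alphabet n) β) :=
  isRelativelyDense_of_le (by omega) hβ (cos_pi_div_pos hn) (one_add_two_mul_cos_eq n ▸ h)

/-! ### The base `τ` -/

lemma monic_tau : (X ^ 2 - X - 1 : ℤ[X]).Monic := by monicity!

lemma natDegree_tau : (X ^ 2 - X - 1 : ℤ[X]).natDegree = 2 := by compute_degree!

lemma irreducible_tau : Irreducible (X ^ 2 - X - 1 : ℤ[X]) := by
  refine irreducible_of_zmod_four monic_tau natDegree_tau.ge
    (natDegree_tau.le.trans (by norm_num)) ?_
  simp only [Polynomial.map_sub, Polynomial.map_pow, map_X, Polynomial.map_one, eval_sub,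
    eval_pow, eval_X, eval_one]
  decide

lemma sqrt_five_sq_complex : ((√5 : ℝ) : ℂ) ^ 2 = 5 := by
  exact_mod_cast congrArg (Complex.ofReal) (Real.sq_sqrt (show (0 : ℝ) ≤ 5 by norm_num))

lemma sqrt_five_bounds : 2.236 < √5 ∧ √5 < 2.237 :=
  ⟨Real.lt_sqrt_of_sq_lt (by norm_num), (Real.sqrt_lt' (by norm_num)).mpr (by norm_num)⟩

lemma aeval_tau (z : ℂ) : aeval z (X ^ 2 - X - 1 : ℤ[X]) =
    (z - ((1 + √5) / 2 : ℝ)) * (z - ((1 - √5) / 2 : ℝ)) := by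
  simp only [map_sub, map_pow, aeval_X, map_one]
  push_cast
  linear_combination (1 / 4 : ℂ) * sqrt_five_sq_complex

lemma tau_facts : IsPisot ((1 + √5) / 2) ∧ (minpoly ℚ ((1 + √5) / 2)).natDegree = 2 ∧
    largestRealRoot (X ^ 2 - X - 1) = (1 + √5) / 2 := by
  have h := sqrt_five_bounds
  exact isPisot_and_natDegree_quadratic monic_tau natDegree_tau irreducible_tau aeval_tau
    (by linarith) (by rw [abs_lt]; constructor <;> linarith)

lemma tau_eq : tau = (1 + √5) / 2 := tau_facts.2.2

lemma tau_sq : tau ^ 2 = tau + 1 := by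
  rw [tau_eq]
  linear_combination (1 / 4 : ℝ) * Real.sq_sqrt (show (0 : ℝ) ≤ 5 by norm_num)

lemma tau_bounds : 1.618 < tau ∧ tau < 1.6185 := by
  rw [tau_eq]
  constructor <;> linarith [sqrt_five_bounds.1, sqrt_five_bounds.2]

lemma tau_sq_facts : IsPisot (tau ^ 2) ∧ (minpoly ℚ (tau ^ 2)).natDegree = 2 := by
  have hm : (X ^ 2 - 3 * X + 1 : ℤ[X]).Monic := by monicity!
  have hd : (X ^ 2 - 3 * X + 1 : ℤ[X]).natDegree = 2 := by compute_degree!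
  have hirr : Irreducible (X ^ 2 - 3 * X + 1 : ℤ[X]) := by
    refine irreducible_of_zmod_four hm hd.ge (hd.le.trans (by norm_num)) ?_
    simp only [Polynomial.map_sub, Polynomial.map_add, Polynomial.map_mul, Polynomial.map_pow,
      map_X, Polynomial.map_one, Polynomial.map_ofNat, eval_sub, eval_add, eval_mul, eval_pow,
      eval_X, eval_one, eval_ofNat]
    decide
  have h := sqrt_five_bounds
  have e : tau ^ 2 = (3 + √5) / 2 := by rw [tau_sq, tau_eq]; ring
  have := isPisot_and_natDegree_quadratic (x := (3 + √5) / 2) (y := (3 - √5) / 2) hm hd hirr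
    (fun z ↦ by
      simp only [map_sub, map_add, map_mul, map_pow, aeval_X, map_one, map_ofNat]
      push_cast
      linear_combination (1 / 4 : ℂ) * sqrt_five_sq_complex)
    (by linarith) (by rw [abs_lt]; constructor <;> linarith)
  rw [e]
  exact ⟨this.1, this.2.1⟩

lemma two_cos_ten : 2 * Real.cos (2 * Real.pi / (10 : ℕ)) = tau := by
  rw [tau_eq, show 2 * Real.pi / (10 : ℕ) = Real.pi / 5 by push_cast; ring, Real.cos_pi_div_five]
  ring

lemma two_cos_five : 2 * Real.cos (2 * Real.pi / (5 : ℕ)) = tau - 1 := by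
  rw [show 2 * Real.pi / (5 : ℕ) = 2 * (2 * Real.pi / (10 : ℕ)) by push_cast; ring,
    Real.cos_two_mul]
  have h := two_cos_ten
  set c := Real.cos (2 * Real.pi / (10 : ℕ))
  linear_combination (2 * c + tau) * h + tau_sq

lemma adjoin_five : Algebra.adjoin ℤ {tau} =
    Algebra.adjoin ℤ {2 * Real.cos (2 * Real.pi / (5 : ℕ))} :=
  adjoin_eq_of_eq (a := 1) (b := 1) (c := 0) (d := -1) (e := 1) (f := 0)
    (by rw [two_cos_five]; push_cast; ring) (by rw [two_cos_five]; push_cast; ring)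

lemma adjoin_ten : Algebra.adjoin ℤ {tau} =
    Algebra.adjoin ℤ {2 * Real.cos (2 * Real.pi / (10 : ℕ))} := by
  rw [two_cos_ten]

lemma adjoin_tau_sq : Algebra.adjoin ℤ {tau ^ 2} = Algebra.adjoin ℤ {tau} :=
  adjoin_eq_of_eq (a := 1) (b := 1) (c := 0) (d := -1) (e := 1) (f := 0)
    (by rw [tau_sq]; push_cast; ring) (by rw [tau_sq]; push_cast; ring)

lemma eq_tau_or_eq_tau_sq {β : ℝ} (hβ : IsPisot β) (hdeg : (minpoly ℚ β).natDegree ≠ 1)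
    (hmem : β ∈ Algebra.adjoin ℤ {tau}) (h3 : β < 3) : β = tau ∨ β = tau ^ 2 := by
  have h := sqrt_five_bounds
  have h1 := hβ.1
  rw [tau_eq] at hmem
  obtain ⟨a, b, e, hab⟩ := exists_eq_of_isPisot_quadratic monic_tau natDegree_tau irreducible_tau
    aeval_tau (by linarith) hβ hdeg hmem
  rw [e] at h1 h3
  rw [abs_lt] at hab
  obtain ⟨h4, h5⟩ := hab
  -- The difference of β and its conjugate is b√5 and lies in (0, 4).
  have hb : b = 1 := by
    have hb0 : (0 : ℝ) < b := by nlinarith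
    have hb2 : (b : ℝ) < 2 := by nlinarith
    have hb0' : 0 < b := by exact_mod_cast hb0
    have hb2' : b < 2 := by exact_mod_cast hb2
    omega
  subst hb
  push_cast at h1 h3 h4 h5
  have ha0 : -1 < a := by
    have : (-1 : ℝ) < a := by linarith
    exact_mod_cast this
  have ha2 : a < 2 := by
    have : (a : ℝ) < 2 := by linarith
    exact_mod_cast this
  obtain rfl | rfl : a = 0 ∨ a = 1 := by omega
  · left; rw [e, tau_eq]; push_cast; ring
  · right; rw [e, tau_sq, tau_eq]; push_cast; ring

lemma not_isRelativelyDense_tau_sq_five :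
    ¬ IsRelativelyDense (digitSpectrum (alphabet 5) (tau ^ 2)) := by
  have h := tau_bounds
  have hc : Real.cos (Real.pi / (5 : ℕ)) ^ 2 = (tau + 1) / 4 := by
    have := one_add_two_mul_cos_eq 5
    rw [two_cos_five] at this
    linarith
  refine not_isRelativelyDense_of_lt (by norm_num) (cos_pi_div_pos (by norm_num)) ?_ ?_
  · rw [tau_sq]; linarith
  -- With β - 1 = τ the expression reduces to (τ - 1)/4.
  · rw [hc, tau_sq]
    nlinarith [tau_sq]

/-! ### The base `δ` -/

lemma monic_delta : (X ^ 2 - 2 * X - 1 : ℤ[X]).Monic := by monicity!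

lemma natDegree_delta : (X ^ 2 - 2 * X - 1 : ℤ[X]).natDegree = 2 := by compute_degree!

lemma irreducible_delta : Irreducible (X ^ 2 - 2 * X - 1 : ℤ[X]) := by
  refine irreducible_of_zmod_four monic_delta natDegree_delta.ge
    (natDegree_delta.le.trans (by norm_num)) ?_
  simp only [Polynomial.map_sub, Polynomial.map_mul, Polynomial.map_pow, map_X,
    Polynomial.map_one, Polynomial.map_ofNat, eval_sub, eval_mul, eval_pow, eval_X, eval_one,
    eval_ofNat]
  decide

lemma sqrt_two_sq_complex : ((√2 : ℝ) : ℂ) ^ 2 = 2 := by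
  exact_mod_cast congrArg (Complex.ofReal) (Real.sq_sqrt (show (0 : ℝ) ≤ 2 by norm_num))

lemma sqrt_two_bounds : 1.414 < √2 ∧ √2 < 1.415 :=
  ⟨Real.lt_sqrt_of_sq_lt (by norm_num), (Real.sqrt_lt' (by norm_num)).mpr (by norm_num)⟩

lemma aeval_delta (z : ℂ) : aeval z (X ^ 2 - 2 * X - 1 : ℤ[X]) =
    (z - (1 + √2 : ℝ)) * (z - (1 - √2 : ℝ)) := by
  simp only [map_sub, map_pow, map_mul, aeval_X, map_one, map_ofNat]
  push_cast
  linear_combination (1 : ℂ) * sqrt_two_sq_complex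

lemma delta_facts : IsPisot (1 + √2) ∧ (minpoly ℚ (1 + √2)).natDegree = 2 ∧
    largestRealRoot (X ^ 2 - 2 * X - 1) = 1 + √2 := by
  have h := sqrt_two_bounds
  exact isPisot_and_natDegree_quadratic monic_delta natDegree_delta irreducible_delta aeval_delta
    (by linarith) (by rw [abs_lt]; constructor <;> linarith)

lemma delta_eq : delta = 1 + √2 := delta_facts.2.2

lemma two_cos_eight : 2 * Real.cos (2 * Real.pi / (8 : ℕ)) = √2 := by
  rw [show 2 * Real.pi / (8 : ℕ) = Real.pi / 4 by push_cast; ring, Real.cos_pi_div_four]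
  ring

lemma adjoin_eight : Algebra.adjoin ℤ {delta} =
    Algebra.adjoin ℤ {2 * Real.cos (2 * Real.pi / (8 : ℕ))} :=
  adjoin_eq_of_eq (a := 1) (b := 1) (c := 0) (d := -1) (e := 1) (f := 0)
    (by rw [two_cos_eight, delta_eq]; push_cast; ring)
    (by rw [two_cos_eight, delta_eq]; push_cast; ring)

lemma eq_delta {β : ℝ} (hβ : IsPisot β) (hdeg : (minpoly ℚ β).natDegree ≠ 1)
    (hmem : β ∈ Algebra.adjoin ℤ {delta}) (h3 : β < 3) : β = delta := by
  have h := sqrt_two_bounds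
  have h1 := hβ.1
  rw [delta_eq] at hmem
  obtain ⟨a, b, e, hab⟩ := exists_eq_of_isPisot_quadratic monic_delta natDegree_delta
    irreducible_delta aeval_delta (by linarith) hβ hdeg hmem
  rw [e] at h1 h3
  rw [abs_lt] at hab
  obtain ⟨h4, h5⟩ := hab
  have hb : b = 1 := by
    have hb0 : (0 : ℝ) < b := by nlinarith
    have hb2 : (b : ℝ) < 2 := by nlinarith
    have hb0' : 0 < b := by exact_mod_cast hb0
    have hb2' : b < 2 := by exact_mod_cast hb2
    omega
  subst hb
  push_cast at h1 h3 h4 h5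
  have ha0 : -1 < a := by
    have : (-1 : ℝ) < a := by linarith
    exact_mod_cast this
  have ha2 : a < 1 := by
    have : (a : ℝ) < 1 := by linarith
    exact_mod_cast this
  obtain rfl : a = 0 := by omega
  rw [e, delta_eq]; push_cast; ring

/-! ### The base `μ` -/

lemma monic_mu : (X ^ 2 - 2 * X - 2 : ℤ[X]).Monic := by monicity!

lemma natDegree_mu : (X ^ 2 - 2 * X - 2 : ℤ[X]).natDegree = 2 := by compute_degree!

lemma irreducible_mu : Irreducible (X ^ 2 - 2 * X - 2 : ℤ[X]) := by
  refine irreducible_of_zmod_four monic_mu natDegree_mu.ge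
    (natDegree_mu.le.trans (by norm_num)) ?_
  simp only [Polynomial.map_sub, Polynomial.map_mul, Polynomial.map_pow, map_X,
    Polynomial.map_ofNat, eval_sub, eval_mul, eval_pow, eval_X, eval_ofNat]
  decide

lemma sqrt_three_sq_complex : ((√3 : ℝ) : ℂ) ^ 2 = 3 := by
  exact_mod_cast congrArg (Complex.ofReal) (Real.sq_sqrt (show (0 : ℝ) ≤ 3 by norm_num))

lemma sqrt_three_bounds : 1.732 < √3 ∧ √3 < 1.733 :=
  ⟨Real.lt_sqrt_of_sq_lt (by norm_num), (Real.sqrt_lt' (by norm_num)).mpr (by norm_num)⟩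

lemma aeval_mu (z : ℂ) : aeval z (X ^ 2 - 2 * X - 2 : ℤ[X]) =
    (z - (1 + √3 : ℝ)) * (z - (1 - √3 : ℝ)) := by
  simp only [map_sub, map_pow, map_mul, aeval_X, map_ofNat]
  push_cast
  linear_combination (1 : ℂ) * sqrt_three_sq_complex

lemma mu_facts : IsPisot (1 + √3) ∧ (minpoly ℚ (1 + √3)).natDegree = 2 ∧
    largestRealRoot (X ^ 2 - 2 * X - 2) = 1 + √3 := by
  have h := sqrt_three_bounds
  exact isPisot_and_natDegree_quadratic monic_mu natDegree_mu irreducible_mu aeval_mu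
    (by linarith) (by rw [abs_lt]; constructor <;> linarith)

lemma mu_eq : mu = 1 + √3 := mu_facts.2.2

lemma two_cos_twelve : 2 * Real.cos (2 * Real.pi / (12 : ℕ)) = √3 := by
  rw [show 2 * Real.pi / (12 : ℕ) = Real.pi / 6 by push_cast; ring, Real.cos_pi_div_six]
  ring

lemma adjoin_twelve : Algebra.adjoin ℤ {mu} =
    Algebra.adjoin ℤ {2 * Real.cos (2 * Real.pi / (12 : ℕ))} :=
  adjoin_eq_of_eq (a := 1) (b := 1) (c := 0) (d := -1) (e := 1) (f := 0)
    (by rw [two_cos_twelve, mu_eq]; push_cast; ring)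
    (by rw [two_cos_twelve, mu_eq]; push_cast; ring)

lemma eq_mu {β : ℝ} (hβ : IsPisot β) (hdeg : (minpoly ℚ β).natDegree ≠ 1)
    (hmem : β ∈ Algebra.adjoin ℤ {mu}) (h3 : β < 3) : β = mu := by
  have h := sqrt_three_bounds
  have h1 := hβ.1
  rw [mu_eq] at hmem
  obtain ⟨a, b, e, hab⟩ := exists_eq_of_isPisot_quadratic monic_mu natDegree_mu
    irreducible_mu aeval_mu (by linarith) hβ hdeg hmem
  rw [e] at h1 h3
  rw [abs_lt] at hab
  obtain ⟨h4, h5⟩ := hab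
  have hb : b = 1 := by
    have hb0 : (0 : ℝ) < b := by nlinarith
    have hb2 : (b : ℝ) < 2 := by nlinarith
    have hb0' : 0 < b := by exact_mod_cast hb0
    have hb2' : b < 2 := by exact_mod_cast hb2
    omega
  subst hb
  push_cast at h1 h3 h4 h5
  have ha0 : -1 < a := by
    have : (-1 : ℝ) < a := by linarith
    exact_mod_cast this
  have ha2 : a < 1 := by
    have : (a : ℝ) < 1 := by linarith
    exact_mod_cast this
  obtain rfl : a = 0 := by omega
  rw [e, mu_eq]; push_cast; ring

/-- Bounds a divided difference P when only a lower bound m for the gap d between two roots is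
known. -/
lemma lt_of_mul_lt_mul_of_le {m d P K : ℝ} (hm : 0 < m) (hd : m ≤ d) (hK : 0 ≤ K)
    (h : d * P < m * K) : P < K := by
  by_contra! hP
  exact absurd h (not_lt.mpr (mul_le_mul hd hP hK (hm.le.trans hd)))

/-! ### The base `λ` -/

lemma monic_lam : (X ^ 3 - 2 * X ^ 2 - X + 1 : ℤ[X]).Monic := by monicity!

lemma natDegree_lam : (X ^ 3 - 2 * X ^ 2 - X + 1 : ℤ[X]).natDegree = 3 := by compute_degree!

lemma irreducible_lam : Irreducible (X ^ 3 - 2 * X ^ 2 - X + 1 : ℤ[X]) := by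
  refine irreducible_of_zmod_four monic_lam (by rw [natDegree_lam]; norm_num) natDegree_lam.le ?_
  simp only [Polynomial.map_sub, Polynomial.map_add, Polynomial.map_mul, Polynomial.map_pow,
    map_X, Polynomial.map_one, Polynomial.map_ofNat, eval_sub, eval_add, eval_mul, eval_pow,
    eval_X, eval_one, eval_ofNat]
  decide

lemma two_cos_fourteen_cubic {t : ℝ} (ht : t = 2 * Real.cos (2 * Real.pi / (14 : ℕ))) :
    t ^ 3 - t ^ 2 - 2 * t + 1 = 0 := by
  rw [show 2 * Real.pi / (14 : ℕ) = Real.pi / 7 by push_cast; ring] at ht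
  -- Since 3θ = π - 4θ for θ = π/7, this is a quartic equation in t; its spurious factor t + 2 is
  -- cancelled below.
  have h1 : Real.cos (3 * (Real.pi / 7)) = -Real.cos (2 * (2 * (Real.pi / 7))) := by
    rw [← Real.cos_pi_sub]
    congr 1
    ring
  rw [Real.cos_three_mul, Real.cos_two_mul, Real.cos_two_mul] at h1
  have hpos : 0 < Real.cos (Real.pi / 7) := by
    simpa using cos_pi_div_pos (n := 7) (by norm_num)
  have h2 : (t + 2) * (t ^ 3 - t ^ 2 - 2 * t + 1) = 0 := by
    rw [ht]
    linear_combination 2 * h1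
  exact (mul_eq_zero.mp h2).resolve_left (by linarith)

lemma two_cos_seven : 2 * Real.cos (2 * Real.pi / (7 : ℕ)) =
    (2 * Real.cos (2 * Real.pi / (14 : ℕ))) ^ 2 - 2 := by
  rw [show 2 * Real.pi / (7 : ℕ) = 2 * (2 * Real.pi / (14 : ℕ)) by push_cast; ring,
    Real.cos_two_mul]
  ring

lemma two_cos_seven_cubic {s : ℝ} (hs : s = 2 * Real.cos (2 * Real.pi / (7 : ℕ))) :
    s ^ 3 + s ^ 2 - 2 * s - 1 = 0 := by
  have h := two_cos_fourteen_cubic rfl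
  rw [two_cos_seven] at hs
  set t := 2 * Real.cos (2 * Real.pi / (14 : ℕ))
  rw [hs]
  linear_combination (t ^ 3 + t ^ 2 - 2 * t - 1) * h

lemma two_cos_fourteen : 2 * Real.cos (2 * Real.pi / (14 : ℕ)) =
    (2 * Real.cos (2 * Real.pi / (7 : ℕ))) ^ 2 + 2 * Real.cos (2 * Real.pi / (7 : ℕ)) - 1 := by
  have h := two_cos_fourteen_cubic rfl
  rw [two_cos_seven]
  set t := 2 * Real.cos (2 * Real.pi / (14 : ℕ))
  linear_combination -(t + 1) * h

lemma two_cos_seven_bounds {s : ℝ} (hs : s = 2 * Real.cos (2 * Real.pi / (7 : ℕ))) :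
    1.246 < s ∧ s < 1.248 := by
  have h := two_cos_seven_cubic hs
  have hpi := Real.pi_pos
  have h1 : 1 < s := by
    have : Real.cos (Real.pi / 3) < Real.cos (2 * Real.pi / (7 : ℕ)) := by
      refine Real.cos_lt_cos_of_nonneg_of_le_pi (by positivity) (by linarith) ?_
      push_cast
      linarith
    rw [Real.cos_pi_div_three] at this
    linarith
  constructor
  · by_contra! h2
    nlinarith [mul_nonneg (sub_nonneg.mpr h1.le) (sub_nonneg.mpr h2)]
  · by_contra! h2
    nlinarith [mul_nonneg (sub_nonneg.mpr h1.le) (sub_nonneg.mpr h2)]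

/-- The conjugates of s are s² - 2, by angle doubling, and 1 - s - s², as the three sum to -1; each
root is one more than a conjugate. -/
lemma aeval_lam {s : ℝ} (hs : s = 2 * Real.cos (2 * Real.pi / (7 : ℕ))) (z : ℂ) :
    aeval z (X ^ 3 - 2 * X ^ 2 - X + 1 : ℤ[X]) =
      (z - (1 + s : ℝ)) * (z - (s ^ 2 - 1 : ℝ)) * (z - (2 - s - s ^ 2 : ℝ)) := by
  have h : (s : ℂ) ^ 3 + (s : ℂ) ^ 2 - 2 * s - 1 = 0 := by exact_mod_cast two_cos_seven_cubic hs
  simp only [map_sub, map_add, map_pow, map_mul, aeval_X, map_one, map_ofNat]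
  push_cast
  linear_combination (z * s - s ^ 2 - s + 1) * h

lemma conj_lam_bounds {s : ℝ} (hs : s = 2 * Real.cos (2 * Real.pi / (7 : ℕ))) :
    (0.552 < s ^ 2 - 1 ∧ s ^ 2 - 1 < 0.558) ∧
      (-0.806 < 2 - s - s ^ 2 ∧ 2 - s - s ^ 2 < -0.798) := by
  obtain ⟨h1, h2⟩ := two_cos_seven_bounds hs
  refine ⟨⟨?_, ?_⟩, ?_, ?_⟩ <;> nlinarith

lemma lam_facts {s : ℝ} (hs : s = 2 * Real.cos (2 * Real.pi / (7 : ℕ))) :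
    IsPisot (1 + s) ∧ (minpoly ℚ (1 + s)).natDegree = 3 ∧
      largestRealRoot (X ^ 3 - 2 * X ^ 2 - X + 1) = 1 + s := by
  obtain ⟨⟨h1, h2⟩, h3, h4⟩ := conj_lam_bounds hs
  have h5 := two_cos_seven_bounds hs
  refine isPisot_and_natDegree_cubic monic_lam natDegree_lam irreducible_lam (aeval_lam hs)
    (by linarith) ?_ ?_ <;> rw [abs_lt] <;> constructor <;> linarith

lemma lam_eq : lam = 1 + 2 * Real.cos (2 * Real.pi / (7 : ℕ)) := (lam_facts rfl).2.2

lemma adjoin_seven : Algebra.adjoin ℤ {lam} =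
    Algebra.adjoin ℤ {2 * Real.cos (2 * Real.pi / (7 : ℕ))} :=
  adjoin_eq_of_eq (a := 1) (b := 1) (c := 0) (d := -1) (e := 1) (f := 0)
    (by rw [lam_eq]; push_cast; ring) (by rw [lam_eq]; push_cast; ring)

lemma adjoin_fourteen : Algebra.adjoin ℤ {lam} =
    Algebra.adjoin ℤ {2 * Real.cos (2 * Real.pi / (14 : ℕ))} :=
  adjoin_seven.trans <|
    adjoin_eq_of_eq (a := -2) (b := 0) (c := 1) (d := -1) (e := 1) (f := 1)
      (by rw [two_cos_seven]; push_cast; ring) (by rw [two_cos_fourteen]; push_cast; ring)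

lemma eq_lam {β : ℝ} (hβ : IsPisot β) (hdeg : (minpoly ℚ β).natDegree ≠ 1)
    (hmem : β ∈ Algebra.adjoin ℤ {lam}) (h3 : β < 3) : β = lam := by
  obtain ⟨s, hs⟩ : ∃ s, s = 2 * Real.cos (2 * Real.pi / (7 : ℕ)) := ⟨_, rfl⟩
  obtain ⟨⟨hy1, hy2⟩, hw1, hw2⟩ := conj_lam_bounds hs
  obtain ⟨hs1, hs2⟩ := two_cos_seven_bounds hs
  rw [lam_eq, ← hs] at hmem ⊢
  have h1 := hβ.1
  obtain ⟨a, b, c, e, hy, hw⟩ := exists_eq_of_isPisot_cubic monic_lam natDegree_lam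
    irreducible_lam (aeval_lam hs) (A := 2) (by push_cast; ring) (by linarith) (by linarith)
    hβ hdeg hmem
  rw [e] at h1 h3
  rw [abs_lt] at hy hw
  obtain ⟨hy3, hy4⟩ := hy
  obtain ⟨hw3, hw4⟩ := hw
  obtain ⟨y, hy⟩ : ∃ y, y = s ^ 2 - 1 := ⟨_, rfl⟩
  obtain ⟨w, hw⟩ : ∃ w, w = 2 - s - s ^ 2 := ⟨_, rfl⟩
  rw [← hy] at hy1 hy2 hy3 hy4
  rw [← hw] at hw1 hw2 hw3 hw4
  have hx : 1 + s = 2 - y - w := by rw [hy, hw]; ring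
  rw [hx] at h1 h3
  -- With f(u) = a + bu + cu² and x = 2 - y - w, the quantities P = b + c(y + w) and Q = b + c(2 -
  -- w) are the divided differences of f over (y, w) and (x, y). Here |f(y) - f(w)| < 2 and 0 < f(x)
  -- - f(y) < 4, while Q - P = c(x - w) bounds c.
  have hP1 : b + c * (y + w) < 1.482 :=
    lt_of_mul_lt_mul_of_le (m := 1.35) (d := y - w) (by norm_num) (by linarith) (by norm_num)
      (by linarith)
  have hP2 : -(b + c * (y + w)) < 1.482 :=
    lt_of_mul_lt_mul_of_le (m := 1.35) (d := y - w) (by norm_num) (by linarith) (by norm_num)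
      (by linarith)
  have hQ1 : b + c * (2 - w) < 2.38 :=
    lt_of_mul_lt_mul_of_le (m := 1.682) (d := 2 - y - w - y) (by norm_num) (by linarith)
      (by norm_num) (by linarith)
  have hQ2 : -(b + c * (2 - w)) < 0 :=
    lt_of_mul_lt_mul_of_le (m := 1.682) (d := 2 - y - w - y) (by norm_num) (by linarith)
      (by norm_num) (by linarith)
  have hc1 : (c : ℝ) < 2 :=
    lt_of_mul_lt_mul_of_le (m := 3) (d := 2 - w - y - w) (by norm_num) (by linarith)
      (by norm_num) (by linarith)
  have hc2 : -(c : ℝ) < 1 :=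
    lt_of_mul_lt_mul_of_le (m := 3) (d := 2 - w - y - w) (by norm_num) (by linarith)
      (by norm_num) (by linarith)
  have hc1' : c < 2 := by exact_mod_cast hc1
  have hc2' : -c < 1 := by exact_mod_cast hc2
  obtain rfl | rfl : c = 0 ∨ c = 1 := by omega
  · push_cast at hP1 hQ2 hy3 hy4 hw3 hw4
    have hb1 : b < 2 := by
      have : (b : ℝ) < 2 := by linarith
      exact_mod_cast this
    have hb2 : 0 < b := by
      have : (0 : ℝ) < b := by linarith
      exact_mod_cast this
    obtain rfl : b = 1 := by omega
    push_cast at hy3 hy4 hw3 hw4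
    have ha1 : a < 1 := by
      have : (a : ℝ) < 1 := by linarith
      exact_mod_cast this
    have ha2 : -1 < a := by
      have : (-1 : ℝ) < a := by linarith
      exact_mod_cast this
    obtain rfl : a = 0 := by omega
    rw [e]; push_cast; ring
  · exfalso
    push_cast at hP2 hQ1 hy3 hy4 hw3 hw4
    have hb1 : b < 0 := by
      have : (b : ℝ) < 0 := by linarith
      exact_mod_cast this
    have hb2 : -2 < b := by
      have : (-2 : ℝ) < b := by linarith
      exact_mod_cast this
    obtain rfl : b = -1 := by omega
    push_cast at hy3 hy4 hw3 hw4
    -- With b = -1 and c = 1, the bound f(w) < 1 forces a < 0, while f(y) > -1 forces a > -1.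
    have ha1 : a < 0 := by
      have : (a : ℝ) < 0 := by nlinarith
      exact_mod_cast this
    have ha2 : -1 < a := by
      have : (-1 : ℝ) < a := by nlinarith
      exact_mod_cast this
    omega

/-! ### The base `κ` -/

lemma monic_kappa : (X ^ 3 - 3 * X ^ 2 + 1 : ℤ[X]).Monic := by monicity!

lemma natDegree_kappa : (X ^ 3 - 3 * X ^ 2 + 1 : ℤ[X]).natDegree = 3 := by compute_degree!

lemma irreducible_kappa : Irreducible (X ^ 3 - 3 * X ^ 2 + 1 : ℤ[X]) := by
  refine irreducible_of_zmod_four monic_kappa (by rw [natDegree_kappa]; norm_num)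
    natDegree_kappa.le ?_
  simp only [Polynomial.map_sub, Polynomial.map_add, Polynomial.map_mul, Polynomial.map_pow,
    map_X, Polynomial.map_one, Polynomial.map_ofNat, eval_sub, eval_add, eval_mul, eval_pow,
    eval_X, eval_one, eval_ofNat]
  decide

lemma two_cos_eighteen_cubic {t : ℝ} (ht : t = 2 * Real.cos (2 * Real.pi / (18 : ℕ))) :
    t ^ 3 = 3 * t + 1 := by
  rw [show 2 * Real.pi / (18 : ℕ) = Real.pi / 9 by push_cast; ring] at ht
  have h1 := Real.cos_three_mul (Real.pi / 9)
  rw [show 3 * (Real.pi / 9) = Real.pi / 3 by ring, Real.cos_pi_div_three] at h1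
  rw [ht]
  linear_combination -2 * h1

lemma two_cos_eighteen_bounds {t : ℝ} (ht : t = 2 * Real.cos (2 * Real.pi / (18 : ℕ))) :
    1.879 < t ∧ t < 1.88 := by
  have h := two_cos_eighteen_cubic ht
  have hpi := Real.pi_pos
  have h1 : 1 < t := by
    have : Real.cos (Real.pi / 3) < Real.cos (2 * Real.pi / (18 : ℕ)) := by
      refine Real.cos_lt_cos_of_nonneg_of_le_pi (by positivity) (by linarith) ?_
      push_cast
      linarith
    rw [Real.cos_pi_div_three] at this
    linarith
  constructor
  · by_contra! h2
    nlinarith [mul_nonneg (sub_nonneg.mpr h1.le) (sub_nonneg.mpr h2)]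
  · by_contra! h2
    nlinarith [mul_nonneg (sub_nonneg.mpr h1.le) (sub_nonneg.mpr h2)]

lemma two_cos_nine : 2 * Real.cos (2 * Real.pi / (9 : ℕ)) =
    (2 * Real.cos (2 * Real.pi / (18 : ℕ))) ^ 2 - 2 := by
  rw [show 2 * Real.pi / (9 : ℕ) = 2 * (2 * Real.pi / (18 : ℕ)) by push_cast; ring,
    Real.cos_two_mul]
  ring

lemma two_cos_eighteen : 2 * Real.cos (2 * Real.pi / (18 : ℕ)) =
    (2 * Real.cos (2 * Real.pi / (9 : ℕ))) ^ 2 + 2 * Real.cos (2 * Real.pi / (9 : ℕ)) - 2 := by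
  have h := two_cos_eighteen_cubic rfl
  rw [two_cos_nine]
  set t := 2 * Real.cos (2 * Real.pi / (18 : ℕ))
  linear_combination -t * h

lemma aeval_kappa {t : ℝ} (ht : t = 2 * Real.cos (2 * Real.pi / (18 : ℕ))) (z : ℂ) :
    aeval z (X ^ 3 - 3 * X ^ 2 + 1 : ℤ[X]) =
      (z - (1 + t : ℝ)) * (z - (t ^ 2 - t - 1 : ℝ)) * (z - (3 - t ^ 2 : ℝ)) := by
  have h : (t : ℂ) ^ 3 = 3 * t + 1 := by exact_mod_cast two_cos_eighteen_cubic ht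
  simp only [map_sub, map_add, map_pow, map_mul, aeval_X, map_one, map_ofNat]
  push_cast
  linear_combination (z * (t - 1) - t ^ 2 + 2) * h

lemma conj_kappa_bounds {t : ℝ} (ht : t = 2 * Real.cos (2 * Real.pi / (18 : ℕ))) :
    (0.65 < t ^ 2 - t - 1 ∧ t ^ 2 - t - 1 < 0.656) ∧
      (-0.535 < 3 - t ^ 2 ∧ 3 - t ^ 2 < -0.53) := by
  obtain ⟨h1, h2⟩ := two_cos_eighteen_bounds ht
  refine ⟨⟨?_, ?_⟩, ?_, ?_⟩ <;> nlinarith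

lemma kappa_facts {t : ℝ} (ht : t = 2 * Real.cos (2 * Real.pi / (18 : ℕ))) :
    IsPisot (1 + t) ∧ (minpoly ℚ (1 + t)).natDegree = 3 ∧
      largestRealRoot (X ^ 3 - 3 * X ^ 2 + 1) = 1 + t := by
  obtain ⟨⟨h1, h2⟩, h3, h4⟩ := conj_kappa_bounds ht
  have h5 := two_cos_eighteen_bounds ht
  refine isPisot_and_natDegree_cubic monic_kappa natDegree_kappa irreducible_kappa
    (aeval_kappa ht) (by linarith) ?_ ?_ <;> rw [abs_lt] <;> constructor <;> linarith

lemma kappa_eq : kappa = 1 + 2 * Real.cos (2 * Real.pi / (18 : ℕ)) := (kappa_facts rfl).2.2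

lemma adjoin_eighteen : Algebra.adjoin ℤ {kappa} =
    Algebra.adjoin ℤ {2 * Real.cos (2 * Real.pi / (18 : ℕ))} :=
  adjoin_eq_of_eq (a := 1) (b := 1) (c := 0) (d := -1) (e := 1) (f := 0)
    (by rw [kappa_eq]; push_cast; ring) (by rw [kappa_eq]; push_cast; ring)

lemma adjoin_nine : Algebra.adjoin ℤ {kappa} =
    Algebra.adjoin ℤ {2 * Real.cos (2 * Real.pi / (9 : ℕ))} :=
  adjoin_eighteen.trans <|
    adjoin_eq_of_eq (a := -2) (b := 1) (c := 1) (d := -2) (e := 0) (f := 1)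
      (by rw [two_cos_eighteen]; push_cast; ring) (by rw [two_cos_nine]; push_cast; ring)

lemma eq_kappa {β : ℝ} (hβ : IsPisot β) (hdeg : (minpoly ℚ β).natDegree ≠ 1)
    (hmem : β ∈ Algebra.adjoin ℤ {kappa}) (h3 : β < 3) : β = kappa := by
  obtain ⟨t, ht⟩ : ∃ t, t = 2 * Real.cos (2 * Real.pi / (18 : ℕ)) := ⟨_, rfl⟩
  obtain ⟨⟨hy1, hy2⟩, hw1, hw2⟩ := conj_kappa_bounds ht
  obtain ⟨ht1, ht2⟩ := two_cos_eighteen_bounds ht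
  rw [kappa_eq, ← ht] at hmem ⊢
  have h1 := hβ.1
  obtain ⟨a, b, c, e, hy, hw⟩ := exists_eq_of_isPisot_cubic monic_kappa natDegree_kappa
    irreducible_kappa (aeval_kappa ht) (A := 3) (by push_cast; ring) (by linarith) (by linarith)
    hβ hdeg hmem
  rw [e] at h1 h3
  rw [abs_lt] at hy hw
  obtain ⟨hy3, hy4⟩ := hy
  obtain ⟨hw3, hw4⟩ := hw
  obtain ⟨y, hy⟩ : ∃ y, y = t ^ 2 - t - 1 := ⟨_, rfl⟩
  obtain ⟨w, hw⟩ : ∃ w, w = 3 - t ^ 2 := ⟨_, rfl⟩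
  rw [← hy] at hy1 hy2 hy3 hy4
  rw [← hw] at hw1 hw2 hw3 hw4
  have hx : 1 + t = 3 - y - w := by rw [hy, hw]; ring
  rw [hx] at h1 h3
  -- The same divided differences as for λ, now with x = 3 - y - w; in the case c = 1 they already
  -- leave no integer b.
  have hP1 : b + c * (y + w) < 1.695 :=
    lt_of_mul_lt_mul_of_le (m := 1.18) (d := y - w) (by norm_num) (by linarith) (by norm_num)
      (by linarith)
  have hP2 : -(b + c * (y + w)) < 1.695 :=
    lt_of_mul_lt_mul_of_le (m := 1.18) (d := y - w) (by norm_num) (by linarith) (by norm_num)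
      (by linarith)
  have hQ1 : b + c * (3 - w) < 1.81 :=
    lt_of_mul_lt_mul_of_le (m := 2.22) (d := 1 + t - y) (by norm_num) (by linarith)
      (by norm_num) (by rw [hx]; linarith)
  have hQ2 : -(b + c * (3 - w)) < 0 :=
    lt_of_mul_lt_mul_of_le (m := 2.22) (d := 1 + t - y) (by norm_num) (by linarith)
      (by norm_num) (by rw [hx]; linarith)
  have hc1 : (c : ℝ) < 2 :=
    lt_of_mul_lt_mul_of_le (m := 3.3) (d := 3 - w - y - w) (by norm_num) (by linarith)
      (by norm_num) (by linarith)
  have hc2 : -(c : ℝ) < 1 :=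
    lt_of_mul_lt_mul_of_le (m := 3.3) (d := 3 - w - y - w) (by norm_num) (by linarith)
      (by norm_num) (by linarith)
  have hc1' : c < 2 := by exact_mod_cast hc1
  have hc2' : -c < 1 := by exact_mod_cast hc2
  obtain rfl | rfl : c = 0 ∨ c = 1 := by omega
  · push_cast at hP1 hQ2 hy3 hy4 hw3 hw4
    have hb1 : b < 2 := by
      have : (b : ℝ) < 2 := by linarith
      exact_mod_cast this
    have hb2 : 0 < b := by
      have : (0 : ℝ) < b := by linarith
      exact_mod_cast this
    obtain rfl : b = 1 := by omega
    push_cast at hy3 hy4 hw3 hw4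
    have ha1 : a < 1 := by
      have : (a : ℝ) < 1 := by linarith
      exact_mod_cast this
    have ha2 : -1 < a := by
      have : (-1 : ℝ) < a := by linarith
      exact_mod_cast this
    obtain rfl : a = 0 := by omega
    rw [e]; push_cast; ring
  · exfalso
    push_cast at hP2 hQ1
    have hb1 : b < -1 := by
      have : (b : ℝ) < -1 := by linarith
      exact_mod_cast this
    have hb2 : -2 < b := by
      have : (-2 : ℝ) < b := by linarith
      exact_mod_cast this
    omega

lemma not_isRelativelyDense_kappa_nine :
    ¬ IsRelativelyDense (digitSpectrum (alphabet 9) kappa) := by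
  obtain ⟨t, ht⟩ : ∃ t, t = 2 * Real.cos (2 * Real.pi / (18 : ℕ)) := ⟨_, rfl⟩
  have h := two_cos_eighteen_bounds ht
  have h3 := two_cos_eighteen_cubic ht
  have hc : Real.cos (Real.pi / (9 : ℕ)) ^ 2 = t ^ 2 / 4 := by
    have := one_add_two_mul_cos_eq 9
    rw [two_cos_nine, ← ht] at this
    linarith
  rw [kappa_eq, ← ht]
  refine not_isRelativelyDense_of_lt (by norm_num) (cos_pi_div_pos (by norm_num)) ?_ ?_
  · linarith
  -- Using t³ = 3t + 1, the expression is 5t²/4 - 3t/2 - 3/2, about 0.095: the margin is small,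
  -- hence the three-decimal bounds on t.
  · rw [hc]
    nlinarith

/-! ### Classification -/

lemma isPisotCyclotomic_and_dense_of_mem {β : ℝ} {n : ℕ} (h : (β, n) ∈ relativelyDensePairs) :
    IsPisotCyclotomic n β ∧ IsQuadraticOrCubic β ∧
      IsRelativelyDense (digitSpectrum (alphabet n) β) := by
  have htau := tau_facts
  rw [← tau_eq] at htau
  have hdelta := delta_facts
  rw [← delta_eq] at hdelta
  have hmu := mu_facts
  rw [← mu_eq] at hmu
  have hlam := lam_facts rfl
  rw [← lam_eq] at hlam
  have hkappa := kappa_facts rfl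
  rw [← kappa_eq] at hkappa
  simp only [relativelyDensePairs, Set.mem_insert_iff, Set.mem_singleton_iff, Prod.mk.injEq] at h
  rcases h with ⟨rfl, rfl⟩ | ⟨rfl, rfl⟩ | ⟨rfl, rfl⟩ | ⟨rfl, rfl⟩ | ⟨rfl, rfl⟩ | ⟨rfl, rfl⟩ |
    ⟨rfl, rfl⟩ | ⟨rfl, rfl⟩
  · refine ⟨⟨by norm_num, htau.1, adjoin_five⟩, Or.inl htau.2.1,
      isRelativelyDense_of_le_cos (by norm_num) htau.1.1 ?_⟩
    rw [two_cos_five]; linarith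
  · refine ⟨⟨by norm_num, htau.1, adjoin_ten⟩, Or.inl htau.2.1,
      isRelativelyDense_of_le_cos (by norm_num) htau.1.1 ?_⟩
    rw [two_cos_ten]; linarith
  · refine ⟨⟨by norm_num, tau_sq_facts.1, adjoin_tau_sq.trans adjoin_ten⟩, Or.inl tau_sq_facts.2,
      isRelativelyDense_of_le_cos (by norm_num) tau_sq_facts.1.1 ?_⟩
    rw [two_cos_ten, tau_sq]; linarith
  · exact ⟨⟨by norm_num, hlam.1, adjoin_seven⟩, Or.inr hlam.2.1,
      isRelativelyDense_of_le_cos (by norm_num) hlam.1.1 lam_eq.le⟩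
  · refine ⟨⟨by norm_num, hlam.1, adjoin_fourteen⟩, Or.inr hlam.2.1,
      isRelativelyDense_of_le_cos (by norm_num) hlam.1.1 ?_⟩
    rw [two_cos_fourteen, lam_eq]
    have := two_cos_seven_bounds rfl
    nlinarith
  · refine ⟨⟨by norm_num, hdelta.1, adjoin_eight⟩, Or.inl hdelta.2.1,
      isRelativelyDense_of_le_cos (by norm_num) hdelta.1.1 ?_⟩
    rw [two_cos_eight, delta_eq]
  · exact ⟨⟨by norm_num, hkappa.1, adjoin_eighteen⟩, Or.inr hkappa.2.1,
      isRelativelyDense_of_le_cos (by norm_num) hkappa.1.1 kappa_eq.le⟩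
  · refine ⟨⟨by norm_num, hmu.1, adjoin_twelve⟩, Or.inl hmu.2.1,
      isRelativelyDense_of_le_cos (by norm_num) hmu.1.1 ?_⟩
    rw [two_cos_twelve, mu_eq]

/-- An integral cosine would make ℤ[β] equal to ℤ and β rational. This removes n = 1, 2, 3, 4, 6. -/
lemma two_cos_ne_intCast {n : ℕ} {β : ℝ} (h : IsPisotCyclotomic n β)
    (hdeg : (minpoly ℚ β).natDegree ≠ 1) (m : ℤ) :
    2 * Real.cos (2 * Real.pi / (n : ℝ)) ≠ m := by
  intro hm
  have hmem : β ∈ Algebra.adjoin ℤ {(m : ℝ)} := by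
    rw [← hm, ← h.2.2]
    exact Algebra.self_mem_adjoin_singleton ℤ β
  obtain ⟨k, hk⟩ := exists_int_eq_of_mem_adjoin hmem
  exact ne_ratCast_of_natDegree_ne_one hdeg k (by rw [hk]; push_cast; rfl)

lemma mem_of_isPisotCyclotomic {n : ℕ} {β : ℝ} (h : IsPisotCyclotomic n β)
    (hdeg : IsQuadraticOrCubic β) : n ∈ ({5, 7, 8, 9, 10, 12, 14, 18} : Finset ℕ) := by
  have h1 : (minpoly ℚ β).natDegree ≠ 1 := by rcases hdeg with h | h <;> omega
  have h3 : (minpoly ℚ β).natDegree ≤ 3 := by rcases hdeg with h | h <;> omega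
  have hmem := mem_of_totient_le_six h.1 ((totient_le_of_isPisotCyclotomic h).trans (by omega))
  have hne := two_cos_ne_intCast h h1
  simp only [Finset.mem_insert, Finset.mem_singleton] at hmem ⊢
  rcases hmem with rfl | rfl | rfl | rfl | rfl | rfl | rfl | rfl | rfl | rfl | rfl | rfl | rfl <;>
    try simp only [true_or, or_true]
  · exact absurd (by simp) (hne 2)
  · exact absurd (by simp) (hne (-2))
  · refine absurd ?_ (hne (-1))
    rw [show 2 * Real.pi / (3 : ℕ) = Real.pi - Real.pi / 3 by push_cast; ring, Real.cos_pi_sub,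
      Real.cos_pi_div_three]
    norm_num
  · refine absurd ?_ (hne 0)
    rw [show 2 * Real.pi / (4 : ℕ) = Real.pi / 2 by push_cast; ring, Real.cos_pi_div_two]
    norm_num
  · refine absurd ?_ (hne 1)
    rw [show 2 * Real.pi / (6 : ℕ) = Real.pi / 3 by push_cast; ring, Real.cos_pi_div_three]
    norm_num

lemma mem_relativelyDensePairs {β : ℝ} {n : ℕ} (h : IsPisotCyclotomic n β)
    (hdeg : IsQuadraticOrCubic β)
    (hdense : IsRelativelyDense (digitSpectrum (alphabet n) β)) :
    (β, n) ∈ relativelyDensePairs := by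
  have hn := mem_of_isPisotCyclotomic h hdeg
  have h1 : (minpoly ℚ β).natDegree ≠ 1 := by rcases hdeg with h | h <;> omega
  have hn4 : 4 ≤ n := by
    simp only [Finset.mem_insert, Finset.mem_singleton] at hn
    omega
  have h3 : β < 3 := by
    by_contra! h3
    exact not_isRelativelyDense_of_three_le hn4 h3 hdense
  have hmem : β ∈ Algebra.adjoin ℤ {2 * Real.cos (2 * Real.pi / (n : ℝ))} := by
    rw [← h.2.2]
    exact Algebra.self_mem_adjoin_singleton ℤ β
  have hP := h.2.1
  simp only [Finset.mem_insert, Finset.mem_singleton] at hn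
  simp only [relativelyDensePairs, Set.mem_insert_iff, Set.mem_singleton_iff, Prod.mk.injEq]
  rcases hn with rfl | rfl | rfl | rfl | rfl | rfl | rfl | rfl
  · rcases eq_tau_or_eq_tau_sq hP h1 (adjoin_five ▸ hmem) h3 with rfl | rfl
    · simp
    · exact absurd hdense not_isRelativelyDense_tau_sq_five
  · simp [eq_lam hP h1 (adjoin_seven ▸ hmem) h3]
  · simp [eq_delta hP h1 (adjoin_eight ▸ hmem) h3]
  · rw [eq_kappa hP h1 (adjoin_nine ▸ hmem) h3] at hdense
    exact absurd hdense not_isRelativelyDense_kappa_nine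
  · rcases eq_tau_or_eq_tau_sq hP h1 (adjoin_ten ▸ hmem) h3 with rfl | rfl <;> simp
  · simp [eq_mu hP h1 (adjoin_twelve ▸ hmem) h3]
  · simp [eq_lam hP h1 (adjoin_fourteen ▸ hmem) h3]
  · simp [eq_kappa hP h1 (adjoin_eighteen ▸ hmem) h3]

end PisotSpectra

theorem mainTheorem6 :
    (∀ (β : ℝ) (n : ℕ), (β, n) ∈ PisotSpectra.relativelyDensePairs →
      PisotSpectra.IsPisotCyclotomic n β ∧ PisotSpectra.IsQuadraticOrCubic β ∧
        PisotSpectra.IsRelativelyDense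
          (PisotSpectra.digitSpectrum (PisotSpectra.alphabet n) β)) ∧
    (PisotSpectra.IsPisotCyclotomic 9 PisotSpectra.kappa ∧
      (minpoly ℚ PisotSpectra.kappa).natDegree = 3 ∧
        ¬ PisotSpectra.IsRelativelyDense
          (PisotSpectra.digitSpectrum (PisotSpectra.alphabet 9) PisotSpectra.kappa)) ∧
    (∀ (β : ℝ) (n : ℕ), PisotSpectra.IsPisotCyclotomic n β →
      PisotSpectra.IsQuadraticOrCubic β →
        (PisotSpectra.IsRelativelyDense
            (PisotSpectra.digitSpectrum (PisotSpectra.alphabet n) β) ↔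
          (β, n) ∈ PisotSpectra.relativelyDensePairs)) := by
  refine ⟨fun β n h ↦ PisotSpectra.isPisotCyclotomic_and_dense_of_mem h, ?_, fun β n h hdeg ↦
    ⟨PisotSpectra.mem_relativelyDensePairs h hdeg,
      fun hmem ↦ (PisotSpectra.isPisotCyclotomic_and_dense_of_mem hmem).2.2⟩⟩
  have hkappa := PisotSpectra.kappa_facts rfl
  rw [← PisotSpectra.kappa_eq] at hkappa
  exact ⟨⟨by norm_num, hkappa.1, PisotSpectra.adjoin_nine⟩, hkappa.2.1,
    PisotSpectra.not_isRelativelyDense_kappa_nine⟩
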